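/- Let $G$ be a simple and simply connected complex algebraic group, with finite reduced irreducible crystallographic root system $R$, finite Weyl group $W$, simple roots $\alpha_i$ and simple coroots $\alpha_i^\vee$ ($i\in I$), highest root $\theta$, coroot lattice $Q^\vee$ and weight lattice $h_{\mathbb Z}^*=\mathrm{Hom}(Q^\vee,\mathbb Z)$. Let $W_{\mathrm{aff}}=W\ltimes Q^\vee$ be the affine Weyl group, with simple generators $r_i$ ($i\in I\cup\{0\}$), where $r_0=t_{\theta^\vee}r_\theta$, and with the corresponding length function $\ell$. Let $W^0\subset W_{\mathrm{aff}}$ be the set of Grassmannian elements, i.e. the minimal length representatives of the cosets $wW\in W_{\mathrm{aff}}/W$. The group $W_{\mathrm{aff}}$ acts on $h_{\mathbb Z}^*$ through the projection $W_{\mathrm{aff}}\to W$; put $\alpha_0^\vee=-\theta^\vee$ for the image of the affine simple coroot. Let $S=\mathrm{Sym}_{\mathbb Z}(h_{\mathbb Z}^*)$ and let $\phi_0:S\to\mathbb Z$ be evaluation at $0$. The affine nilHecke ring $\mathbb A_{\mathrm{aff}}$ is the ring generated by $S$ and elements $A_i$ ($i\in I\cup\{0\}$) subject to the relations $A_i\lambda=(r_i\cdot\lambda)A_i+\langle\lambda,\alpha_i^\vee\rangle$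 for $\lambda\in h_{\mathbb Z}^*$, $A_i^2=0$, and $\underbrace{A_iA_jA_i\cdots}_{m}=\underbrace{A_jA_iA_j\cdots}_{m}$ whenever $\underbrace{r_ir_jr_i\cdots}_{m}=\underbrace{r_jr_ir_j\cdots}_{m}$ in $W_{\mathrm{aff}}$. For $w\in W_{\mathrm{aff}}$ let $A_w=A_{i_1}\cdots A_{i_l}$ for a reduced decomposition $w=r_{i_1}\cdots r_{i_l}$; the $A_w$ form an $S$-basis of $\mathbb A_{\mathrm{aff}}$. Let $\mathbb A_0\subset\mathbb A_{\mathrm{aff}}$ be the subring generated by the $A_i$, let $\phi_0:\mathbb A_{\mathrm{aff}}\to\mathbb A_0$ be the map $\sum_w a_wA_w\mapsto\sum_w\phi_0(a_w)A_w$, and let $$\mathbb B'=\{a\in\mathbb A_0\mid \phi_0(as)=\phi_0(s)\,a\ \text{ for all } s\in S\}$$ be the affine Fomin–Stanley subalgebra. **Proposition.** Every nonzero $b\in\mathbb B'$ can be written uniquely as a finite sum $b=\sum_{w\in W_{\mathrm{aff}}}b_wA_w$ with $b_w\in\mathbb Z$, and $b_w\neq0$ for some $w\in W^0$. -/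

import Mathlib

noncomputable section

namespace AffineNilHecke

variable {ι X Y : Type*} [AddCommGroup X] [AddCommGroup Y]

/-- A root datum is irreducible when it has a root and its roots cannot be split into two
nonempty mutually orthogonal parts. (Mathlib's `RootPairing.IsIrreducible` is meant for field
coefficients: a lattice always has proper invariant sublattices.) -/
def IsIrreducibleDatum (P : RootDatum ι X Y) : Prop :=
  Nonempty ι ∧ ∀ Φ : Set ι, Φ.Nonempty →
    (∀ i ∈ Φ, ∀ j, j ∉ Φ → P.pairing i j = 0) → Φ = Set.univ

/-- `θ` is the highest root: `θ - α` is a sum of simple roots for every root `α`. -/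
def IsHighestRoot {P : RootDatum ι X Y} (b : P.Base) (θ : ι) : Prop :=
  ∀ i, P.root θ - P.root i ∈ AddSubmonoid.closure (P.root '' b.support)

/-- The action of the finite Weyl group on the coweight lattice `Y`; it is contragredient to the
action on the weight lattice `X`. -/
def coweightAction (P : RootDatum ι X Y) : P.weylGroup →* MulAut (Multiplicative Y) where
  toFun w := AddEquiv.toMultiplicative
    (RootPairing.Equiv.coweightEquiv P P (w⁻¹ : P.weylGroup).1).toAddEquiv
  map_one' := by
    ext y
    simp
  map_mul' v w := by
    ext y
    simp

/-- The affine Weyl group `W ⋉ Y`, used here when `Y` is the coroot lattice. -/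
abbrev AffineWeyl (P : RootDatum ι X Y) : Type _ :=
  Multiplicative Y ⋊[coweightAction P] P.weylGroup

/-- The translation `t_μ`. -/
def translation (P : RootDatum ι X Y) (μ : Y) : AffineWeyl P :=
  SemidirectProduct.inl (Multiplicative.ofAdd μ)

/-- The inclusion of the finite Weyl group. -/
def ofFinite (P : RootDatum ι X Y) : P.weylGroup →* AffineWeyl P :=
  SemidirectProduct.inr

/-- The level zero action of the affine Weyl group on the weight lattice: translations act
trivially (the imaginary root `δ` is sent to `0`). -/
def levelZero (P : RootDatum ι X Y) (w : AffineWeyl P) (μ : X) : X := w.right • μ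

variable {P : RootDatum ι X Y} (b : P.Base) (θ : ι)

/-- Affine Dynkin nodes: `none` is the node `0`, the others are the finite simple roots. -/
abbrev Node : Type _ := Option b.support

/-- The simple generators `r_i`, with `r_0 = t_{θ^∨} r_θ`. -/
def simpleRefl : Node b → AffineWeyl P
  | some i => ofFinite P (RootPairing.weylGroup.ofIdx P i)
  | none => translation P (P.coroot θ) * ofFinite P (RootPairing.weylGroup.ofIdx P θ)

/-- The images `α_i^∨` of the simple affine coroots, with `α_0^∨ ↦ -θ^∨`. -/
def simpleCoroot : Node b → Y
  | some i => P.coroot i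
  | none => -P.coroot θ

/-- The element of the affine Weyl group spelled by a word. -/
def wordProd (ω : List (Node b)) : AffineWeyl P := (ω.map (simpleRefl b θ)).prod

/-- The length function of the affine Weyl group. -/
def len (w : AffineWeyl P) : ℕ := sInf {n | ∃ ω, wordProd b θ ω = w ∧ ω.length = n}

/-- `ω` is a reduced decomposition of `w`. -/
def IsReducedWord (w : AffineWeyl P) (ω : List (Node b)) : Prop :=
  wordProd b θ ω = w ∧ ω.length = len b θ w

/-- The Grassmannian elements: `w` has minimal length in its coset `w W`. -/
def IsGrassmannian (w : AffineWeyl P) : Prop :=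
  ∀ v : P.weylGroup, len b θ w ≤ len b θ (w * ofFinite P v)

/-- The free ring on symbols `A_i` for nodes `i` and `λ` for weights `λ`. -/
abbrev FreeRing (_b : P.Base) : Type _ := FreeAlgebra ℤ (Node _b ⊕ X)

/-- The symbol `A_i` in the free ring. -/
abbrev symA (i : Node b) : FreeRing b := FreeAlgebra.ι ℤ (Sum.inl i)

/-- The symbol `λ` in the free ring. -/
abbrev symWt (μ : X) : FreeRing b := FreeAlgebra.ι ℤ (Sum.inr μ)

open CoxeterSystem in
/-- The defining relations of the affine nilHecke ring. The first two make the scalars a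
commutative ring containing the additive group of weights. -/
inductive Rel : FreeRing b → FreeRing b → Prop
  | add (μ ν : X) : Rel (symWt b (μ + ν)) (symWt b μ + symWt b ν)
  | comm (μ ν : X) : Rel (symWt b μ * symWt b ν) (symWt b ν * symWt b μ)
  | leibniz (i : Node b) (μ : X) :
      Rel (symA b i * symWt b μ)
        (symWt b (levelZero P (simpleRefl b θ i) μ) * symA b i
          + algebraMap ℤ _ (P.toLinearMap μ (simpleCoroot b θ i)))
  | nil (i : Node b) : Rel (symA b i * symA b i) 0
  | braid (i j : Node b) (m : ℕ)
      (h : wordProd b θ (alternatingWord i j m) = wordProd b θ (alternatingWord j i m)) :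
      Rel ((alternatingWord i j m).map (symA b)).prod ((alternatingWord j i m).map (symA b)).prod

/-- The affine nilHecke ring. -/
abbrev NilHecke : Type _ := RingQuot (Rel b θ)

/-- The generator `A_i` of the affine nilHecke ring. -/
def genA (i : Node b) : NilHecke b θ := RingQuot.mkAlgHom ℤ (Rel b θ) (symA b i)

/-- The weights as elements of the affine nilHecke ring. -/
def weight : X →ₗ[ℤ] NilHecke b θ :=
  (AddMonoidHom.mk' (fun μ => RingQuot.mkAlgHom ℤ (Rel b θ) (symWt b μ)) fun μ ν => by
    rw [← map_add]
    exact RingQuot.mkAlgHom_rel ℤ (Rel.add μ ν)).toIntLinearMap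

theorem weight_comm (μ ν : X) :
    weight b θ μ * weight b θ ν = weight b θ ν * weight b θ μ := by
  change RingQuot.mkAlgHom ℤ (Rel b θ) (symWt b μ) * RingQuot.mkAlgHom ℤ (Rel b θ) (symWt b ν) =
    RingQuot.mkAlgHom ℤ (Rel b θ) (symWt b ν) * RingQuot.mkAlgHom ℤ (Rel b θ) (symWt b μ)
  rw [← map_mul, ← map_mul]
  exact RingQuot.mkAlgHom_rel ℤ (Rel.comm μ ν)

/-- The canonical map from `S`, the symmetric algebra of the weight lattice, to the affine
nilHecke ring, extending `weight`. -/
def scalar : SymmetricAlgebra ℤ X →ₐ[ℤ] NilHecke b θ :=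
  RingCon.liftₐ (TensorAlgebra.symRingCon ℤ X) (TensorAlgebra.lift ℤ (weight b θ)) <|
    RingCon.ringConGen_le.2 fun x y h => by
      induction h with
      | mul_comm μ ν =>
        rw [RingCon.ker_apply]
        change TensorAlgebra.lift ℤ (weight b θ) (TensorAlgebra.ι ℤ μ * TensorAlgebra.ι ℤ ν) =
          TensorAlgebra.lift ℤ (weight b θ) (TensorAlgebra.ι ℤ ν * TensorAlgebra.ι ℤ μ)
        rw [map_mul, map_mul]
        have key (κ : X) :
            TensorAlgebra.lift ℤ (weight b θ) (TensorAlgebra.ι ℤ κ) = weight b θ κ :=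
          TensorAlgebra.lift_ι_apply (weight b θ) κ
        rw [key, key, weight_comm]

theorem scalar_ι (μ : X) : scalar b θ (SymmetricAlgebra.ι ℤ X μ) = weight b θ μ :=
  TensorAlgebra.lift_ι_apply (weight b θ) μ

/-- The element `A_w`, the product of the generators along a reduced decomposition of `w`. -/
def basisA (w : AffineWeyl P) : NilHecke b θ :=
  ((Classical.epsilon (IsReducedWord b θ w)).map (genA b θ)).prod

/-- `∑_w c_w A_w` for coefficients `c_w ∈ S`. -/
def expansion (c : AffineWeyl P →₀ SymmetricAlgebra ℤ X) : NilHecke b θ :=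
  c.sum fun w s => scalar b θ s * basisA b θ w

/-- `∑_w c_w A_w` for coefficients `c_w ∈ ℤ`. -/
def intExpansion (c : AffineWeyl P →₀ ℤ) : NilHecke b θ :=
  c.sum fun w n => n • basisA b θ w

/-- The evaluation `S → ℤ` of a polynomial at `0`. -/
abbrev evalZero : SymmetricAlgebra ℤ X →ₐ[ℤ] ℤ := SymmetricAlgebra.algebraMapInv

/-- The graph of the specialization map `φ₀ : ∑_w c_w A_w ↦ ∑_w φ₀(c_w) A_w`;
it says `φ₀(x) = y`. -/
def Specializes (x y : NilHecke b θ) : Prop :=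
  ∃ c : AffineWeyl P →₀ SymmetricAlgebra ℤ X, x = expansion b θ c ∧
    y = intExpansion b θ (c.mapRange evalZero (map_zero _))

/-- The affine nilCoxeter algebra, the subring generated by the `A_i`. -/
def nilCoxeter : Subalgebra ℤ (NilHecke b θ) := Algebra.adjoin ℤ (Set.range (genA b θ))

/-- The affine Fomin–Stanley subalgebra
`{a ∈ A₀ | φ₀(a s) = φ₀(s) a for all s ∈ S}`. -/
def fominStanley : Set (NilHecke b θ) :=
  {a | a ∈ nilCoxeter b θ ∧
    ∀ s : SymmetricAlgebra ℤ X, Specializes b θ (a * scalar b θ s) (evalZero s • a)}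

end AffineNilHecke

end

/-!
Write an element `a` of the affine Fomin–Stanley subalgebra as `∑ a_w A_w` with integral `a_w`, and
factor each `w = u v` with `u` Grassmannian and `v` in the finite Weyl group, lengths adding up, so
that `A_w = A_u A_v`. Suppose that `a_u = 0` for all Grassmannian `u`, and among the cosets `uW`
meeting the support of `a` choose one with `u` of maximal length, and `a_{u v₀} ≠ 0` in it; then
`v₀ ≠ 1`. For `t ∈ S` the coefficient of `A_u` in `φ₀(a t)` only involves that coset: it equals
`∑_v a_{uv} φ₀(∂_v t)`, where `∂_v` is the divided difference operator
(`regWord_apply_grassmannian`). There is a `t` without constant term for which `φ₀(∂_v t)` vanishes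
exactly when `v ≠ v₀` (`exists_dual_polynomial`), and for it `φ₀(a t) = φ₀(t) a = 0` forces
`a_{u v₀} = 0`, a contradiction.

The polynomial `t` is `∂_x (λ^N)`, where `λ` is a regular dominant weight, `v₀ x` is the longest
element of the finite Weyl group, and `N` is its length. That works because `φ₀(∂_w λ^{ℓ(w)}) > 0`
for all finite `w`, by induction from the Leibniz rule, whose coefficients are pairings of `λ` with
positive coroots (`demWord_ι_mul`), and because `v x` is the longest element only for `v = v₀`.

All this presupposes that the `A_w` are linearly independent, and that those with integral
coefficients span the subring generated by the `A_i`. Spanning is Matsumoto's theorem together with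
the vanishing of products along words that are not reduced; both are derived from the exchange
condition, which is obtained from the action on affine roots (`affineSystem`). For independence the
ring is represented on the free `S`-module on the affine Weyl group (`regRep`), where
`A_i (s A_w) = ∂_i(s) A_w + r_i(s) A_{r_i w}` and `A_w` sends the generator `A_1` to `A_w`. The braid
relations hold there because the difference `D` of the two sides satisfies `D λ = w(λ) D`, where `w`
is the common product of the two words (`regWord_alternatingWord_smul`), and annihilates each `A_w`.
-/

noncomputable section

namespace AffineNilHecke

open CoxeterSystem (alternatingWord alternatingWord_succ length_alternatingWord)

section

/-! ### Groups generated by reflections -/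

/-- A group `G` generated by involutions `s i`, acting on a set `Φ` of roots with a notion of
positivity for which `s i` sends only one positive root, `root i`, to a negative one. -/
structure ReflectionSystem (G B Φ : Type*) [Group G] [MulAction G Φ] where
  /-- the generating reflections -/
  s : B → G
  /-- the simple roots -/
  root : B → Φ
  /-- positivity of roots -/
  pos : Φ → Prop
  s_mul_s : ∀ i, s i * s i = 1
  pos_root : ∀ i, pos (root i)
  pos_smul : ∀ i β, pos β → β ≠ root i → pos (s i • β)
  pos_mul_s_smul : ∀ g i, pos ((g * s i) • root i) ↔ ¬ pos (g • root i)
  mul_s_of_smul_root : ∀ g i j, g • root i = root j → g * s i = s j * g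
  exists_word : ∀ g, ∃ ω : List B, (ω.map s).prod = g

namespace ReflectionSystem

variable {G B Φ : Type*} [Group G] [MulAction G Φ] (R : ReflectionSystem G B Φ)

/-- The product of the reflections along a word. -/
def word (ω : List B) : G := (ω.map R.s).prod

/-- The minimal length of a word with product `g`. -/
def length (g : G) : ℕ := sInf {n | ∃ ω, R.word ω = g ∧ ω.length = n}

/-- A word is reduced when no shorter word has the same product. -/
def Reduced (ω : List B) : Prop := R.length (R.word ω) = ω.length

@[simp] theorem word_nil : R.word [] = 1 := rfl

@[simp] theorem word_cons (i : B) (ω : List B) : R.word (i :: ω) = R.s i * R.word ω := by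
  simp [word]

@[simp] theorem word_append (ω ω' : List B) : R.word (ω ++ ω') = R.word ω * R.word ω' := by
  simp [word]

theorem exists_reduced (g : G) : ∃ ω, R.word ω = g ∧ ω.length = R.length g :=
  Nat.sInf_mem (s := {n | ∃ ω, R.word ω = g ∧ ω.length = n})
    ((R.exists_word g).elim fun ω h => ⟨_, ω, h, rfl⟩)

theorem length_word_le (ω : List B) : R.length (R.word ω) ≤ ω.length :=
  Nat.sInf_le ⟨ω, rfl, rfl⟩

theorem length_one : R.length 1 = 0 := Nat.le_zero.1 (R.length_word_le [])

theorem eq_one_of_length_eq_zero {g : G} (h : R.length g = 0) : g = 1 := by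
  obtain ⟨ω, rfl, hl⟩ := R.exists_reduced g
  rw [h, List.length_eq_zero_iff] at hl
  simp [hl]

theorem length_mul_le (g h : G) : R.length (g * h) ≤ R.length g + R.length h := by
  obtain ⟨ω, rfl, hl⟩ := R.exists_reduced g
  obtain ⟨ω', rfl, hl'⟩ := R.exists_reduced h
  rw [← hl, ← hl', ← word_append, ← List.length_append]
  exact R.length_word_le _

theorem length_s_le (i : B) : R.length (R.s i) ≤ 1 := by
  simpa using R.length_word_le [i]

theorem length_s_mul_le (i : B) (g : G) : R.length (R.s i * g) ≤ R.length g + 1 := by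
  have := R.length_mul_le (R.s i) g
  have := R.length_s_le i
  omega

theorem word_reverse (ω : List B) : R.word ω.reverse = (R.word ω)⁻¹ := by
  induction ω with
  | nil => simp
  | cons i ω ih =>
    have : (R.s i)⁻¹ = R.s i := inv_eq_of_mul_eq_one_right (R.s_mul_s i)
    simp [ih, this]

theorem length_inv (g : G) : R.length g⁻¹ = R.length g := by
  have key (g : G) : R.length g⁻¹ ≤ R.length g := by
    obtain ⟨ω, rfl, hl⟩ := R.exists_reduced g
    rw [← word_reverse, ← hl]
    simpa using R.length_word_le ω.reverse
  exact le_antisymm (key g) (by simpa using key g⁻¹)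

variable {R}

theorem Reduced.of_append {ω ω' : List B} (h : R.Reduced (ω ++ ω')) :
    R.Reduced ω ∧ R.Reduced ω' := by
  have h1 := R.length_word_le ω
  have h2 := R.length_word_le ω'
  have h3 := R.length_mul_le (R.word ω) (R.word ω')
  unfold Reduced at *
  simp only [word_append, List.length_append] at h
  omega

theorem Reduced.congr {ω ω' : List B} (h : R.Reduced ω) (hw : R.word ω = R.word ω')
    (hl : ω.length = ω'.length) : R.Reduced ω' := by
  unfold Reduced at *
  rw [← hw, h, hl]

variable (R)

/-- The exchange condition, for a root `g • root i` in the orbit of a simple root. -/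
theorem exchange_general (g : G) (i : B) (hg : R.pos (g • R.root i)) (ω : List B)
    (h : ¬ R.pos (R.word ω • g • R.root i)) :
    ∃ ω₁ j ω₂, ω = ω₁ ++ j :: ω₂ ∧ R.word ω * g * R.s i = R.word (ω₁ ++ ω₂) * g := by
  induction ω with
  | nil => simp [hg] at h
  | cons j ω ih =>
    by_cases hp : R.pos (R.word ω • g • R.root i)
    · have hj : R.word ω • g • R.root i = R.root j := by
        by_contra hne
        exact h (by simpa [mul_smul] using R.pos_smul j _ hp hne)
      refine ⟨[], j, ω, rfl, ?_⟩
      have := R.mul_s_of_smul_root (R.word ω * g) i j (by rw [mul_smul, hj])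
      rw [word_cons, mul_assoc (R.s j), mul_assoc (R.s j), this, ← mul_assoc, R.s_mul_s]
      simp
    · obtain ⟨ω₁, k, ω₂, rfl, hk⟩ := ih hp
      refine ⟨j :: ω₁, k, ω₂, rfl, ?_⟩
      rw [word_cons, mul_assoc (R.s j), mul_assoc (R.s j), hk]
      simp [mul_assoc]

theorem exchange (ω : List B) (i : B) (h : ¬ R.pos (R.word ω • R.root i)) :
    ∃ ω₁ j ω₂, ω = ω₁ ++ j :: ω₂ ∧ R.word ω * R.s i = R.word (ω₁ ++ ω₂) := by
  simpa using R.exchange_general 1 i (by simpa using R.pos_root i) ω (by simpa using h)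

theorem length_mul_s_of_neg {g : G} {i : B} (h : ¬ R.pos (g • R.root i)) :
    R.length (g * R.s i) + 1 = R.length g := by
  obtain ⟨ω, rfl, hl⟩ := R.exists_reduced g
  obtain ⟨ω₁, j, ω₂, rfl, hw⟩ := R.exchange ω i h
  have h1 := R.length_word_le (ω₁ ++ ω₂)
  have h2 := R.length_mul_le (R.word (ω₁ ++ j :: ω₂) * R.s i) (R.s i)
  rw [mul_assoc _ (R.s i), R.s_mul_s, mul_one] at h2
  have h3 := R.length_s_le i
  rw [← hw] at h1
  simp only [List.length_append, List.length_cons] at hl h1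
  omega

theorem length_mul_s_of_pos {g : G} {i : B} (h : R.pos (g • R.root i)) :
    R.length (g * R.s i) = R.length g + 1 := by
  have := R.length_mul_s_of_neg (g := g * R.s i) (i := i) (by
    rw [R.pos_mul_s_smul]; exact not_not.2 h)
  rwa [mul_assoc, R.s_mul_s, mul_one, eq_comm] at this

theorem pos_smul_root_iff (g : G) (i : B) :
    R.pos (g • R.root i) ↔ R.length (g * R.s i) = R.length g + 1 := by
  refine ⟨R.length_mul_s_of_pos, fun h => ?_⟩
  by_contra hn
  have := R.length_mul_s_of_neg hn
  omega

theorem reduced_concat_iff (ω : List B) (i : B) :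
    R.Reduced (ω ++ [i]) ↔ R.Reduced ω ∧ R.pos (R.word ω • R.root i) := by
  constructor
  · intro h
    refine ⟨h.of_append.1, ?_⟩
    have h1 := h.of_append.1
    rw [pos_smul_root_iff]
    unfold Reduced at h h1
    simp only [word_append, word_cons, word_nil, mul_one, List.length_append, List.length_cons,
      List.length_nil] at h
    omega
  · rintro ⟨h, hp⟩
    unfold Reduced at *
    simp [R.length_mul_s_of_pos hp, h]

theorem not_reduced_concat_concat (ω : List B) (i : B) : ¬ R.Reduced (ω ++ [i] ++ [i]) := by
  intro h
  have := R.length_word_le ω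
  unfold Reduced at h
  simp only [word_append, word_cons, word_nil, mul_one, mul_assoc, R.s_mul_s, List.length_append,
      List.length_cons, List.length_nil] at h
  omega

theorem not_pos_of_reduced_concat {ω : List B} {i : B} (h : R.Reduced (ω ++ [i])) :
    ¬ R.pos (R.word (ω ++ [i]) • R.root i) := by
  rw [word_append, word_cons, word_nil, mul_one, R.pos_mul_s_smul, not_not]
  exact ((R.reduced_concat_iff ω i).1 h).2

/-- A reduced word in two letters alternates. -/
theorem Reduced.eq_alternatingWord {i j : B} (σ : List B) (h : ∀ k ∈ σ, k = i ∨ k = j)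
    (hr : R.Reduced σ) : σ = alternatingWord i j σ.length ∨ σ = alternatingWord j i σ.length := by
  induction σ using List.reverseRecOn with
  | nil => simp [alternatingWord]
  | append_singleton σ k ih =>
    have hk : k = i ∨ k = j := h k (by simp)
    have ih := ih (fun l hl => h l (by simp [hl])) hr.of_append.1
    rw [List.length_append, List.length_singleton, alternatingWord_succ, alternatingWord_succ,
      List.concat_eq_append, List.concat_eq_append]
    rcases hn : σ.length with _ | n
    · rw [List.length_eq_zero_iff] at hn
      subst hn
      rcases hk with rfl | rfl <;> simp [alternatingWord]
    · rw [hn] at ih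
      -- the last letter of `σ` differs from `k`
      have hne {l : B} {τ : List B} (hσ : σ = τ ++ [l]) : l ≠ k := by
        rintro rfl
        exact R.not_reduced_concat_concat τ l (hσ ▸ hr)
      rcases ih with ih | ih
      · have := hne (ih.trans (by rw [alternatingWord_succ, List.concat_eq_append]))
        rcases hk with rfl | rfl
        · exact Or.inr (by rw [← ih])
        · exact absurd rfl this
      · have := hne (ih.trans (by rw [alternatingWord_succ, List.concat_eq_append]))
        rcases hk with rfl | rfl
        · exact absurd rfl this
        · exact Or.inl (by rw [← ih])

theorem mem_alternatingWord {i j k : B} {m : ℕ} (h : k ∈ alternatingWord i j m) :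
    k = i ∨ k = j := by
  induction m generalizing i j with
  | zero => simp [alternatingWord] at h
  | succ m ih =>
    rw [alternatingWord_succ, List.concat_eq_append, List.mem_append, List.mem_singleton] at h
    rcases h with h | h
    · exact (ih h).symm
    · exact Or.inr h

/-- An alternating word which sends the other simple root to a negative root represents the
longest element of its dihedral group. -/
theorem word_alternatingWord_comm {i j : B} {m : ℕ} (h : R.Reduced (alternatingWord j i m))
    (hn : ¬ R.pos (R.word (alternatingWord j i m) • R.root j)) :
    R.word (alternatingWord i j m) = R.word (alternatingWord j i m) := by
  obtain ⟨ω₁, l, ω₂, hω, hw⟩ := R.exchange _ _ hn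
  have hlen : (ω₁ ++ ω₂).length + 1 = m := by
    have := congrArg List.length hω
    rw [length_alternatingWord] at this
    simp only [this, List.length_append, List.length_cons]
    omega
  have hlet : ∀ k ∈ ω₁ ++ ω₂, k = j ∨ k = i := fun k hk =>
    mem_alternatingWord (m := m) (hω ▸ by
      rw [List.mem_append] at hk
      rcases hk with hk | hk <;> simp [hk])
  have hw' : R.word (alternatingWord j i m) = R.word (ω₁ ++ ω₂ ++ [j]) := by
    rw [word_append, ← hw, word_cons, word_nil, mul_one, mul_assoc, R.s_mul_s, mul_one]
  have hred : R.Reduced (ω₁ ++ ω₂ ++ [j]) :=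
    h.congr hw' (by rw [length_alternatingWord, List.length_append, hlen.symm]; rfl)
  have halt := Reduced.eq_alternatingWord R _ hlet hred.of_append.1
  obtain ⟨n, rfl⟩ : ∃ n, m = n + 1 := ⟨_, hlen.symm⟩
  obtain rfl : (ω₁ ++ ω₂).length = n := by omega
  rw [hw', alternatingWord_succ i j, List.concat_eq_append]
  rcases halt with halt | halt
  · rw [← halt]
  · rcases hn : (ω₁ ++ ω₂).length with _ | n
    · rw [List.length_eq_zero_iff] at hn
      simp [hn, alternatingWord]
    · rw [hn, alternatingWord_succ, List.concat_eq_append] at halt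
      exact absurd (halt ▸ hred) (R.not_reduced_concat_concat _ _)

variable {R}

/-- If `s f * σ = σ * s i` with `σ * s i` reduced, then `σ` carries `root i` to `root f`. -/
theorem Reduced.word_smul_root {σ : List B} {i f : B} (h : R.Reduced (σ ++ [i]))
    (hf : R.word (f :: σ) = R.word (σ ++ [i])) : R.word σ • R.root i = R.root f := by
  by_contra hne
  have := R.pos_smul f _ ((R.reduced_concat_iff σ i).1 h).2 hne
  rw [← mul_smul, ← word_cons, hf] at this
  exact R.not_pos_of_reduced_concat h this

theorem root_eq_of_s_eq {i j : B} (h : R.s i = R.s j) : R.root i = R.root j := by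
  by_contra hne
  have := R.pos_smul j _ (R.pos_root i) hne
  rw [← h, ← one_mul (R.s i), R.pos_mul_s_smul, one_smul] at this
  exact this (R.pos_root i)

variable (R)

section Matsumoto

variable {K : Type*} [MonoidWithZero K] (F : B → K)

theorem prod_map_eq_of_alternating_suffix
    (braid : ∀ i j m, R.Reduced (alternatingWord i j m) →
      R.word (alternatingWord i j m) = R.word (alternatingWord j i m) →
      ((alternatingWord i j m).map F).prod = ((alternatingWord j i m).map F).prod)
    (n : ℕ)
    (ih : ∀ ω ω' : List B, ω.length < n → R.Reduced ω → R.Reduced ω' → R.word ω = R.word ω' →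
      (ω.map F).prod = (ω'.map F).prod)
    (d m : ℕ) (i j : B) (τ τ' : List B) (hm : 0 < m) (hd : d + m = n) (hτ : τ.length = d)
    (hτ' : τ'.length = d) (h : R.Reduced (τ ++ alternatingWord i j m))
    (h' : R.Reduced (τ' ++ alternatingWord j i m))
    (hw : R.word (τ ++ alternatingWord i j m) = R.word (τ' ++ alternatingWord j i m)) :
    ((τ ++ alternatingWord i j m).map F).prod = ((τ' ++ alternatingWord j i m).map F).prod := by
  have same_last (τ τ' : List B) (k : B) (h : R.Reduced (τ ++ [k])) (h' : R.Reduced (τ' ++ [k]))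
      (hn : τ.length < n) (hw : R.word (τ ++ [k]) = R.word (τ' ++ [k])) :
      ((τ ++ [k]).map F).prod = ((τ' ++ [k]).map F).prod := by
    rw [word_append, word_append, mul_left_inj] at hw
    rw [List.map_append, List.map_append, List.prod_append, List.prod_append,
      ih τ τ' hn h.of_append.1 h'.of_append.1 hw]
  -- If the alternating suffixes have the same product, then so do the prefixes.
  have same_suffix (i j : B) (m : ℕ) (τ τ' : List B) (hn : τ.length < n)
      (h : R.Reduced (τ ++ alternatingWord i j m)) (h' : R.Reduced (τ' ++ alternatingWord j i m))
      (hw : R.word (τ ++ alternatingWord i j m) = R.word (τ' ++ alternatingWord j i m))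
      (hs : R.word (alternatingWord i j m) = R.word (alternatingWord j i m)) :
      ((τ ++ alternatingWord i j m).map F).prod = ((τ' ++ alternatingWord j i m).map F).prod := by
    rw [word_append, word_append, hs, mul_left_inj] at hw
    rw [List.map_append, List.map_append, List.prod_append, List.prod_append,
      braid i j m h.of_append.2 hs, ih τ τ' hn h.of_append.1 h'.of_append.1 hw]
  induction d generalizing m i j τ τ' with
  | zero =>
    rw [List.length_eq_zero_iff] at hτ hτ'
    subst hτ hτ'
    exact same_suffix i j m [] [] (by simpa using by omega) h h' hw (by simpa using hw)
  | succ d ihd =>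
    -- Otherwise exchange makes one alternating suffix longer.
    have step (i j : B) (τ τ' : List B) (hτ : τ.length = d + 1)
        (h : R.Reduced (τ ++ alternatingWord i j m))
        (h' : R.Reduced (τ' ++ alternatingWord j i m))
        (hw : R.word (τ ++ alternatingWord i j m) = R.word (τ' ++ alternatingWord j i m)) :
        R.word (alternatingWord i j m) = R.word (alternatingWord j i m) ∨
        ∃ τ'' : List B, τ''.length = d ∧
          R.word (τ'' ++ alternatingWord j i (m + 1)) = R.word (τ' ++ alternatingWord j i m) := by
      by_cases hp : R.pos (R.word (alternatingWord i j m) • R.root i)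
      · right
        have hneg : ¬ R.pos (R.word τ • R.word (alternatingWord i j m) • R.root i) := by
          rw [← mul_smul, ← word_append, hw]
          obtain ⟨k, rfl⟩ : ∃ k, m = k + 1 := ⟨m - 1, by omega⟩
          rw [alternatingWord_succ, List.concat_eq_append, ← List.append_assoc] at h' ⊢
          exact R.not_pos_of_reduced_concat h'
        obtain ⟨τ₁, k, τ₂, rfl, hk⟩ := R.exchange_general _ _ hp τ hneg
        refine ⟨τ₁ ++ τ₂, ?_, ?_⟩
        · simp only [List.length_append, List.length_cons] at hτ ⊢
          omega
        · rw [alternatingWord_succ, List.concat_eq_append, ← List.append_assoc, word_append _ _ [i],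
            word_append, ← hk, word_cons, word_nil, mul_one, mul_assoc _ (R.s i), R.s_mul_s,
            mul_one, ← word_append, hw]
      · exact Or.inl (R.word_alternatingWord_comm h.of_append.2 hp).symm
    rcases step i j τ τ' hτ h h' hw with hs | ⟨τ₁, hτ₁, hw₁⟩
    · exact same_suffix i j m τ τ' (by omega) h h' hw hs
    rcases step j i τ' τ hτ' h' h hw.symm with hs | ⟨τ₂, hτ₂, hw₂⟩
    · exact same_suffix i j m τ τ' (by omega) h h' hw hs.symm
    have h₁ := h'.congr hw₁.symm (by
      rw [List.length_append, List.length_append, length_alternatingWord, length_alternatingWord]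
      omega)
    have h₂ := h.congr hw₂.symm (by
      rw [List.length_append, List.length_append, length_alternatingWord, length_alternatingWord]
      omega)
    have e := ihd (m + 1) j i τ₁ τ₂ (by omega) (by omega) hτ₁ hτ₂ h₁ h₂ (by rw [hw₁, hw₂, hw])
    obtain ⟨k, rfl⟩ : ∃ k, m = k + 1 := ⟨m - 1, by omega⟩
    have e₁ := same_last (τ₁ ++ alternatingWord i j (k + 1)) (τ' ++ alternatingWord i j k) i
    have e₂ := same_last (τ₂ ++ alternatingWord j i (k + 1)) (τ ++ alternatingWord j i k) j
    have hcat (a b : B) (l : ℕ) (σ : List B) :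
        σ ++ alternatingWord b a l ++ [b] = σ ++ alternatingWord a b (l + 1) := by
      rw [alternatingWord_succ, List.concat_eq_append, List.append_assoc]
    simp only [hcat, List.length_append, length_alternatingWord] at e₁ e₂
    rw [← e₂ h₂ h (by omega) hw₂, ← e₁ h₁ h' (by omega) hw₁, e]

/-- Matsumoto's theorem: a product over a reduced word depends only on the element it spells, as
soon as the braid relations between reduced alternating words hold. -/
theorem prod_map_eq_of_reduced
    (braid : ∀ i j m, R.Reduced (alternatingWord i j m) →
      R.word (alternatingWord i j m) = R.word (alternatingWord j i m) →
      ((alternatingWord i j m).map F).prod = ((alternatingWord j i m).map F).prod)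
    {ω ω' : List B} (h : R.Reduced ω) (h' : R.Reduced ω') (hw : R.word ω = R.word ω') :
    (ω.map F).prod = (ω'.map F).prod := by
  induction hn : ω.length using Nat.strong_induction_on generalizing ω ω' with
  | _ n ih =>
    have hl : ω.length = ω'.length := by rw [← h, ← h', hw]
    rcases List.eq_nil_or_concat' ω with rfl | ⟨τ, j, rfl⟩
    · rw [List.length_nil, eq_comm, List.length_eq_zero_iff] at hl
      rw [hl]
    rcases List.eq_nil_or_concat' ω' with rfl | ⟨τ', i, rfl⟩
    · simp at hl
    simp only [List.length_append, List.length_singleton] at hn hl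
    exact R.prod_map_eq_of_alternating_suffix F braid n
      (fun _ _ hlt h h' hw => ih _ hlt h h' hw rfl) τ.length 1 i j τ τ' one_pos hn rfl (by omega)
      h h' hw

theorem prod_map_eq_zero_of_not_reduced (sq : ∀ i, F i * F i = 0)
    (braid : ∀ i j m, R.Reduced (alternatingWord i j m) →
      R.word (alternatingWord i j m) = R.word (alternatingWord j i m) →
      ((alternatingWord i j m).map F).prod = ((alternatingWord j i m).map F).prod)
    {ω : List B} (h : ¬ R.Reduced ω) : (ω.map F).prod = 0 := by
  induction ω using List.reverseRecOn with
  | nil => exact absurd R.length_one h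
  | append_singleton ω i ih =>
    rw [List.map_append, List.prod_append, List.map_singleton, List.prod_singleton]
    by_cases hr : R.Reduced ω
    · -- By exchange, some reduced word for the same element as `ω` ends with `i`.
      have hn : ¬ R.pos (R.word ω • R.root i) := fun hp => h ((R.reduced_concat_iff ω i).2 ⟨hr, hp⟩)
      obtain ⟨ω₁, j, ω₂, rfl, hw⟩ := R.exchange ω i hn
      have hw' : R.word (ω₁ ++ j :: ω₂) = R.word (ω₁ ++ ω₂ ++ [i]) := by
        rw [word_append _ _ [i], ← hw, word_cons, word_nil, mul_one, mul_assoc, R.s_mul_s, mul_one]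
      rw [R.prod_map_eq_of_reduced F braid hr (hr.congr hw' (by simp)) hw',
        List.map_append, List.prod_append, List.map_singleton, List.prod_singleton, mul_assoc,
        sq, mul_zero]
    · rw [ih hr, zero_mul]

end Matsumoto

section Cosets

variable (J : Set B)

/-- `u` has minimal length in its coset of the parabolic subgroup generated by `J`. -/
def IsMinimal (u : G) : Prop :=
  ∀ ω : List B, (∀ i ∈ ω, i ∈ J) → R.length u ≤ R.length (u * R.word ω)

variable {J} {R}

theorem isMinimal_one : R.IsMinimal J 1 := fun _ _ => R.length_one ▸ Nat.zero_le _

/-- Lengths add in the parabolic factorization, and the second factor is spelled by `J`. -/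
theorem IsMinimal.exists_word {u : G} (hu : R.IsMinimal J u) (ω : List B) (hω : ∀ i ∈ ω, i ∈ J) :
    ∃ ω' : List B, (∀ i ∈ ω', i ∈ J) ∧ R.word ω' = R.word ω ∧
      R.length (u * R.word ω) = R.length u + ω'.length := by
  induction ω using List.reverseRecOn with
  | nil => exact ⟨[], by simp⟩
  | append_singleton ω i ih =>
    obtain ⟨ω', hJ, hw, hl⟩ := ih fun k hk => hω k (by simp [hk])
    have hi : i ∈ J := hω i (by simp)
    rw [word_append, word_cons, word_nil, mul_one, ← hw, ← mul_assoc]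
    rw [← hw] at hl
    by_cases hp : R.pos ((u * R.word ω') • R.root i)
    · refine ⟨ω' ++ [i], ?_, by simp, ?_⟩
      · simpa using fun k hk => hk.elim (hJ k) (· ▸ hi)
      · rw [R.length_mul_s_of_pos hp, hl, List.length_append, List.length_singleton, add_assoc]
    by_cases hp' : R.pos (R.word ω' • R.root i)
    · -- `u` would send a positive root of the parabolic to a negative one, so that exchange
      -- yields a shorter element of its coset.
      exfalso
      obtain ⟨σ, rfl, hσ⟩ := R.exists_reduced u
      obtain ⟨σ₁, j, σ₂, rfl, hx⟩ := R.exchange_general _ _ hp' σ (by rwa [← mul_smul])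
      have hmin := hu (ω' ++ [i] ++ ω'.reverse) (by
        simp only [List.mem_append, List.mem_reverse, List.mem_singleton]
        rintro k ((hk | rfl) | hk)
        exacts [hJ k hk, hi, hJ k hk])
      rw [show R.word (ω' ++ [i] ++ ω'.reverse) = R.word ω' * R.s i * (R.word ω')⁻¹ by
        simp [word_reverse, mul_assoc], ← mul_assoc, ← mul_assoc, hx, mul_inv_cancel_right] at hmin
      have := R.length_word_le (σ₁ ++ σ₂)
      simp only [List.length_append, List.length_cons] at this hσ
      omega
    · obtain ⟨ω₁, j, ω₂, rfl, hx⟩ := R.exchange ω' i hp'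
      refine ⟨ω₁ ++ ω₂, fun k hk => hJ k ?_, hx.symm, ?_⟩
      · rw [List.mem_append] at hk
        rcases hk with hk | hk <;> simp [hk]
      · have := R.length_mul_s_of_neg hp
        simp only [List.length_append, List.length_cons] at hl ⊢
        omega

end Cosets

end ReflectionSystem

end

section

variable {ι X Y : Type*} [AddCommGroup X] [AddCommGroup Y]

/-! ### The affine root system -/

section Action

variable (P : RootDatum ι X Y)

theorem root_smul (w : P.weylGroup) (i : ι) : P.root (w • i) = w • P.root i :=
  (P.weylGroup_apply_root w i).symm

theorem pairing_coweightAction (w : P.weylGroup) (μ : X) (y : Multiplicative Y) :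
    P.toLinearMap (w • μ) (coweightAction P w y).toAdd = P.toLinearMap μ y.toAdd := by
  have h := RootPairing.Hom.weight_coweight_transpose_apply P P y.toAdd (w⁻¹ : P.weylGroup).1.toHom
  have h' := LinearMap.congr_fun h (w • μ)
  refine h'.symm.trans ?_
  change P.toLinearMap (w⁻¹ • w • μ) y.toAdd = _
  rw [inv_smul_smul]

theorem coweightAction_coroot (w : P.weylGroup) (i : ι) :
    coweightAction P w (Multiplicative.ofAdd (P.coroot i)) =
      Multiplicative.ofAdd (P.coroot (w • i)) := by
  have h := RootPairing.Hom.coroot_coweightMap_apply P P i (w⁻¹ : P.weylGroup).1.toHom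
  exact congrArg Multiplicative.ofAdd h

theorem pairing_smul_coroot (w : P.weylGroup) (μ : X) (i : ι) :
    P.toLinearMap (w • μ) (P.coroot (w • i)) = P.toLinearMap μ (P.coroot i) := by
  have := pairing_coweightAction P w μ (Multiplicative.ofAdd (P.coroot i))
  rwa [coweightAction_coroot] at this

theorem pairing_smul_smul (w : P.weylGroup) (i j : ι) :
    P.pairing (w • i) (w • j) = P.pairing i j := by
  have := pairing_smul_coroot P w (P.root i) j
  rwa [← root_smul] at this

theorem ofIdx_smul_index (i j : ι) :
    RootPairing.weylGroup.ofIdx P i • j = P.reflectionPerm i j := rfl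

theorem ofIdx_smul_weight (i : ι) (μ : X) :
    RootPairing.weylGroup.ofIdx P i • μ = μ - P.toLinearMap μ (P.coroot i) • P.root i := rfl

theorem weylGroup_ext {v w : P.weylGroup} (h : ∀ μ : X, v • μ = w • μ) : v = w :=
  Subtype.ext (RootPairing.Equiv.weightHom_injective P (LinearEquiv.ext h))

theorem mul_ofIdx (w : P.weylGroup) (i : ι) :
    w * RootPairing.weylGroup.ofIdx P i = RootPairing.weylGroup.ofIdx P (w • i) * w := by
  refine weylGroup_ext P fun μ => ?_
  rw [mul_smul, mul_smul, ofIdx_smul_weight, ofIdx_smul_weight, pairing_smul_coroot, smul_sub,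
    root_smul, smul_comm w]

theorem ofIdx_mul_self (i : ι) :
    RootPairing.weylGroup.ofIdx P i * RootPairing.weylGroup.ofIdx P i = 1 := by
  refine weylGroup_ext P fun μ => ?_
  rw [mul_smul, one_smul]
  exact P.reflection_same i μ

/-- The real affine roots `α + nδ`, as pairs `(α, n)`. -/
@[ext]
structure AffineRoot (P : RootDatum ι X Y) where
  /-- the underlying finite root -/
  index : ι
  /-- the coefficient of `δ` -/
  level : ℤ

variable {P}

instance : MulAction (AffineWeyl P) (AffineRoot P) where
  smul w β := ⟨w.right • β.index,
    β.level - P.toLinearMap (P.root (w.right • β.index)) w.left.toAdd⟩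
  one_smul β := by
    refine AffineRoot.ext (one_smul _ _) ?_
    change β.level - P.toLinearMap _ (0 : Y) = β.level
    simp
  mul_smul v w β := by
    refine AffineRoot.ext (mul_smul _ _ _) ?_
    change β.level - P.toLinearMap (P.root ((v.right * w.right) • β.index))
        (v.left.toAdd + (coweightAction P v.right w.left).toAdd) =
      β.level - P.toLinearMap (P.root (w.right • β.index)) w.left.toAdd -
        P.toLinearMap (P.root (v.right • w.right • β.index)) v.left.toAdd
    rw [map_add, mul_smul, root_smul P v.right, pairing_coweightAction]
    ring

theorem smul_index (w : AffineWeyl P) (β : AffineRoot P) :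
    (w • β).index = w.right • β.index := rfl

theorem smul_level (w : AffineWeyl P) (β : AffineRoot P) :
    (w • β).level = β.level - P.toLinearMap (P.root (w.right • β.index)) w.left.toAdd := rfl

/-- The reflection in an affine root. -/
def AffineRoot.refl (β : AffineRoot P) : AffineWeyl P :=
  translation P (-β.level • P.coroot β.index) * ofFinite P (RootPairing.weylGroup.ofIdx P β.index)

theorem refl_left (β : AffineRoot P) :
    β.refl.left = Multiplicative.ofAdd (-β.level • P.coroot β.index) := by
  rw [AffineRoot.refl, SemidirectProduct.mul_left]
  change Multiplicative.ofAdd _ * coweightAction P 1 1 = _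
  rw [map_one, mul_one]

theorem refl_right (β : AffineRoot P) :
    β.refl.right = RootPairing.weylGroup.ofIdx P β.index := by
  rw [AffineRoot.refl, SemidirectProduct.mul_right]
  exact one_mul _

theorem coweightAction_ofIdx (i : ι) (y : Y) :
    coweightAction P (RootPairing.weylGroup.ofIdx P i) (Multiplicative.ofAdd y) =
      Multiplicative.ofAdd (y - P.toLinearMap (P.root i) y • P.coroot i) := by
  have : (RootPairing.weylGroup.ofIdx P i)⁻¹ = RootPairing.weylGroup.ofIdx P i :=
    inv_eq_of_mul_eq_one_right (ofIdx_mul_self P i)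
  change Multiplicative.ofAdd
    (RootPairing.Equiv.coweightEquiv P P (RootPairing.weylGroup.ofIdx P i)⁻¹.1 y) = _
  rw [this]
  rfl

theorem mul_refl (w : AffineWeyl P) (β : AffineRoot P) : w * β.refl = (w • β).refl * w := by
  refine SemidirectProduct.ext ?_ ?_
  · rw [SemidirectProduct.mul_left, SemidirectProduct.mul_left, refl_left, refl_left, refl_right,
      smul_index, smul_level]
    obtain ⟨y, hy⟩ : ∃ y : Y, w.left = Multiplicative.ofAdd y := ⟨w.left.toAdd, rfl⟩
    rw [hy, coweightAction_ofIdx, neg_smul, neg_smul, ofAdd_neg, map_inv, ofAdd_zsmul, map_zpow,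
      coweightAction_coroot, ← ofAdd_zsmul, ← ofAdd_neg, ← ofAdd_add, ← ofAdd_add, toAdd_ofAdd]
    congr 1
    module
  · rw [SemidirectProduct.mul_right, SemidirectProduct.mul_right, refl_right, refl_right,
      smul_index, mul_ofIdx]

theorem refl_mul_refl (β : AffineRoot P) : β.refl * β.refl = 1 := by
  refine SemidirectProduct.ext ?_ ?_
  · rw [SemidirectProduct.mul_left, refl_left, refl_right, coweightAction_ofIdx, ← ofAdd_add]
    have := P.root_coroot_two β.index
    rw [map_smul, this, SemidirectProduct.one_left, ← ofAdd_zero]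
    congr 1
    simp only [smul_eq_mul]
    module
  · rw [SemidirectProduct.mul_right, refl_right, ofIdx_mul_self, SemidirectProduct.one_right]

/-- The negative of an affine root. -/
def AffineRoot.neg (β : AffineRoot P) : AffineRoot P :=
  ⟨P.reflectionPerm β.index β.index, -β.level⟩

theorem root_reflectionPerm_same (i : ι) : P.root (P.reflectionPerm i i) = -P.root i := by simp

theorem coroot_reflectionPerm_same (i : ι) : P.coroot (P.reflectionPerm i i) = -P.coroot i := by
  simp

theorem smul_neg_root (w : AffineWeyl P) (β : AffineRoot P) : w • β.neg = (w • β).neg := by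
  have h : w.right • P.reflectionPerm β.index β.index =
      P.reflectionPerm (w.right • β.index) (w.right • β.index) := by
    apply P.root.injective
    rw [root_smul, root_reflectionPerm_same, root_reflectionPerm_same, smul_neg, root_smul]
  refine AffineRoot.ext h ?_
  change -β.level - P.toLinearMap (P.root (w.right • P.reflectionPerm β.index β.index)) _ =
    -(β.level - P.toLinearMap (P.root (w.right • β.index)) _)
  rw [h, root_reflectionPerm_same, map_neg, LinearMap.neg_apply]
  ring

theorem refl_smul (β γ : AffineRoot P) :
    β.refl • γ = ⟨P.reflectionPerm β.index γ.index,
      γ.level - P.pairing γ.index β.index * β.level⟩ := by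
  refine AffineRoot.ext ?_ ?_
  · rw [smul_index, refl_right, ofIdx_smul_index]
  · rw [smul_level, refl_right, ofIdx_smul_index, refl_left, toAdd_ofAdd, map_smul,
      P.root_coroot_eq_pairing, ← P.pairing_reflectionPerm, P.pairing_reflectionPerm_self_right]
    simp only [smul_eq_mul]
    ring

theorem refl_smul_self (β : AffineRoot P) : β.refl • β = β.neg := by
  rw [refl_smul, P.pairing_same, AffineRoot.neg]
  congr 1
  ring

end Action

end

section

variable {ι X Y : Type*} [AddCommGroup X] [AddCommGroup Y] {P : RootDatum ι X Y}

theorem reflection_reflectionPerm_same (i : ι) (μ : X) :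
    P.reflection (P.reflectionPerm i i) μ = P.reflection i μ := by
  rw [P.reflection_apply, P.reflection_apply, root_reflectionPerm_same, RootPairing.coroot',
    coroot_reflectionPerm_same]
  simp

theorem ofIdx_reflectionPerm_same (i : ι) :
    RootPairing.weylGroup.ofIdx P (P.reflectionPerm i i) = RootPairing.weylGroup.ofIdx P i :=
  weylGroup_ext P fun μ => reflection_reflectionPerm_same i μ

section Height

variable {b : P.Base} {θ : ι}

theorem height_reflectionPerm_same (i : ι) : b.height (P.reflectionPerm i i) = -b.height i :=
  b.height_reflectionPerm_self i

theorem isPos_reflectionPerm_same (i : ι) : b.IsPos (P.reflectionPerm i i) ↔ ¬ b.IsPos i :=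
  RootPairing.Base.IsPos.neg_iff_not b i

theorem exists_eq_sum_of_mem_closure {x : X} (hx : x ∈ AddSubmonoid.closure (P.root '' b.support)) :
    ∃ f : ι → ℤ, 0 ≤ f ∧ x = ∑ j ∈ b.support, f j • P.root j := by
  classical
  induction hx using AddSubmonoid.closure_induction with
  | mem x hx =>
    obtain ⟨j, hj, rfl⟩ := hx
    refine ⟨Pi.single j 1, by simp, ?_⟩
    rw [Finset.sum_eq_single_of_mem j hj (by simp_all)]
    simp
  | zero => exact ⟨0, le_rfl, by simp⟩
  | add x y _ _ hx hy =>
    obtain ⟨f, hf, rfl⟩ := hx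
    obtain ⟨g, hg, rfl⟩ := hy
    exact ⟨f + g, add_nonneg hf hg, by simp [add_smul, Finset.sum_add_distrib]⟩

theorem height_le_of_isHighestRoot (hθ : IsHighestRoot b θ) (i : ι) : b.height i ≤ b.height θ := by
  obtain ⟨f, hf, he⟩ := exists_eq_sum_of_mem_closure (hθ i)
  obtain ⟨g, -, -, hg⟩ := b.exists_root_eq_sum_int i
  have h : P.root θ = ∑ j ∈ b.support, (f + g) j • P.root j := by
    rw [← sub_add_cancel (P.root θ) (P.root i), he, hg]
    simp [add_smul, Finset.sum_add_distrib]
  rw [RootPairing.Base.height_eq_sum hg, RootPairing.Base.height_eq_sum h]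
  exact Finset.sum_le_sum fun j _ => by simpa using hf j

theorem isPos_of_isHighestRoot (hθ : IsHighestRoot b θ) : b.IsPos θ := by
  rw [b.isPos_iff]
  have h1 := height_le_of_isHighestRoot hθ (P.reflectionPerm θ θ)
  rw [height_reflectionPerm_same] at h1
  have := b.height_ne_zero θ
  omega

variable [Finite ι]

theorem pairing_highest_nonneg (hθ : IsHighestRoot b θ) {i : ι} (hi : b.IsPos i) :
    0 ≤ P.pairing i θ := by
  by_contra! hneg
  have hp := isPos_of_isHighestRoot hθ
  rw [b.isPos_iff] at hi hp
  have hne : P.root i ≠ -P.root θ := by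
    rw [← root_reflectionPerm_same]
    intro h
    rw [P.root.injective h, height_reflectionPerm_same] at hi
    omega
  obtain ⟨k, hk⟩ := P.root_add_root_mem_of_pairingIn_neg
    (i := i) (j := θ) (by rw [← P.algebraMap_pairingIn ℤ] at hneg; simpa using hneg) hne
  have h1 := b.height_add hk
  have h2 := height_le_of_isHighestRoot hθ k
  omega

theorem pairing_highest_le_one (hθ : IsHighestRoot b θ) {i : ι} (hne : i ≠ θ) :
    P.pairing i θ ≤ 1 := by
  by_contra! hlt
  have hp := isPos_of_isHighestRoot hθ
  rw [b.isPos_iff] at hp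
  obtain ⟨k, hk⟩ := P.root_sub_root_mem_of_pairingIn_pos
    (i := i) (j := θ) (by rw [← P.algebraMap_pairingIn ℤ] at hlt; simp at hlt; omega) hne
  have h1 := b.height_sub hk
  have h2 := height_le_of_isHighestRoot hθ i
  have h3 := b.height_ne_zero k
  have hr : P.root (P.reflectionPerm θ i) = P.root i + (-P.pairing i θ) • P.root θ := by
    rw [P.root_reflectionPerm, P.reflection_apply_root, neg_smul, sub_eq_add_neg]
  have h5 := b.height_add_zsmul hr
  have h6 := height_le_of_isHighestRoot hθ
    (P.reflectionPerm (P.reflectionPerm θ i) (P.reflectionPerm θ i))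
  rw [height_reflectionPerm_same] at h6
  simp only [smul_eq_mul] at h5
  -- The root `-(s_θ α_i)` is too high unless `α_i` is as high as `θ`, but then `α_i - θ` would be
  -- a root of non-negative height.
  nlinarith [lt_of_le_of_ne h2 (by omega : b.height i ≠ b.height θ)]

end Height

variable (b : P.Base) (θ : ι)

/-- Positivity of affine roots. -/
def AffineRoot.IsPos (β : AffineRoot P) : Prop := 0 < β.level ∨ β.level = 0 ∧ b.IsPos β.index

/-- The simple affine roots; the one at the node `0` is `δ - θ`. -/
def simpleRoot : Node b → AffineRoot P
  | some i => ⟨i, 0⟩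
  | none => ⟨P.reflectionPerm θ θ, 1⟩

variable {b θ}

theorem isPos_neg_iff (β : AffineRoot P) : β.neg.IsPos b ↔ ¬ β.IsPos b := by
  change 0 < -β.level ∨ -β.level = 0 ∧ b.IsPos (P.reflectionPerm _ _) ↔ _
  rw [isPos_reflectionPerm_same, AffineRoot.IsPos]
  by_cases h : b.IsPos β.index <;> simp only [h, not_true_eq_false, not_false_eq_true, and_true,
    and_false, or_false] <;> omega

theorem simpleRefl_eq_refl (i : Node b) : simpleRefl b θ i = (simpleRoot b θ i).refl := by
  rcases i with _ | i
  · refine SemidirectProduct.ext ?_ ?_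
    · rw [refl_left]
      change Multiplicative.ofAdd _ * coweightAction P 1 1 = _
      rw [map_one, mul_one]
      simp [simpleRoot]
    · rw [refl_right]
      refine (one_mul _).trans (weylGroup_ext P fun μ => ?_)
      change RootPairing.weylGroup.ofIdx P θ • μ = RootPairing.weylGroup.ofIdx P
        (P.reflectionPerm θ θ) • μ
      rw [ofIdx_reflectionPerm_same]
  · refine SemidirectProduct.ext ?_ ?_
    · rw [refl_left]
      simp [simpleRoot, simpleRefl, ofFinite]
    · rw [refl_right]
      rfl

theorem simpleCoroot_eq (i : Node b) :
    simpleCoroot b θ i = P.coroot (simpleRoot b θ i).index := by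
  rcases i with _ | i
  · simp [simpleCoroot, simpleRoot]
  · rfl

theorem simpleRoot_injective : Function.Injective (simpleRoot b θ) := by
  rintro (_ | i) (_ | j) h
  · rfl
  · exact absurd (congrArg AffineRoot.level h) one_ne_zero
  · exact absurd (congrArg AffineRoot.level h) zero_ne_one
  · exact congrArg some (Subtype.ext (congrArg AffineRoot.index h))

theorem isPos_simpleRoot (i : Node b) : (simpleRoot b θ i).IsPos b := by
  rcases i with _ | i
  · exact Or.inl one_pos
  · exact Or.inr ⟨rfl, RootPairing.Base.isPos_of_mem_support i.2⟩

theorem isPos_simpleRefl_smul [Finite ι] [P.IsReduced] (hθ : IsHighestRoot b θ) (i : Node b)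
    (β : AffineRoot P) (h : β.IsPos b) (hne : β ≠ simpleRoot b θ i) :
    (simpleRefl b θ i • β).IsPos b := by
  rw [simpleRefl_eq_refl, refl_smul]
  obtain ⟨k, n⟩ := β
  rcases i with _ | i
  · have hθp := isPos_of_isHighestRoot hθ
    have hr : P.root (P.reflectionPerm θ k) = P.root k + (-P.pairing k θ) • P.root θ := by
      rw [P.root_reflectionPerm, P.reflection_apply_root, neg_smul, sub_eq_add_neg]
    have hh := b.height_add_zsmul hr
    have hperm : P.reflectionPerm (P.reflectionPerm θ θ) k = P.reflectionPerm θ k := by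
      apply P.root.injective
      rw [P.root_reflectionPerm, P.root_reflectionPerm, reflection_reflectionPerm_same]
    simp only [AffineRoot.IsPos, simpleRoot, P.pairing_reflectionPerm_self_right, hperm] at h hne ⊢
    rw [b.isPos_iff] at hθp ⊢
    simp only [smul_eq_mul] at hh
    by_cases hk : b.IsPos k
    · have h0 := pairing_highest_nonneg hθ hk
      rcases h0.eq_or_lt with h0 | h0
      · rw [← h0] at hh ⊢
        rw [neg_zero, zero_mul, add_zero] at hh
        rw [b.isPos_iff] at h hk
        omega
      · omega
    · have hk' := (isPos_reflectionPerm_same (b := b) k).2 hk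
      have h0 := pairing_highest_nonneg hθ hk'
      have hn : 0 < n := by tauto
      by_cases hkθ : P.reflectionPerm k k = θ
      · have hk2 : k = P.reflectionPerm θ θ := by
          apply P.root.injective
          rw [root_reflectionPerm_same, ← hkθ, root_reflectionPerm_same, neg_neg]
        have hn1 : n ≠ 1 := fun h1 => hne (by rw [h1, hk2])
        rw [hk2] at hh ⊢
        rw [P.pairing_reflectionPerm_self_left, P.pairing_same] at hh ⊢
        rw [height_reflectionPerm_same] at hh
        omega
      · have h1 := pairing_highest_le_one hθ hkθ
        rw [P.pairing_reflectionPerm_self_left] at h0 h1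
        have := height_le_of_isHighestRoot hθ (P.reflectionPerm k k)
        rw [height_reflectionPerm_same] at this
        have hz := b.height_ne_zero (P.reflectionPerm θ k)
        by_cases hp : P.pairing k θ = -1
        · rw [hp] at hh ⊢
          omega
        · omega
  · simp only [AffineRoot.IsPos, simpleRoot, mul_zero, sub_zero] at h hne ⊢
    refine h.imp_right fun ⟨h0, hk⟩ => ⟨h0, hk.reflectionPerm i.2 ?_⟩
    rintro rfl
    exact hne (by rw [h0])

section Generation

variable (b θ)

theorem mem_closure_of_finite [Finite ι] [P.IsReduced] (v : P.weylGroup) :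
    ofFinite P v ∈ Subgroup.closure (Set.range fun i : b.support => ofFinite P
      (RootPairing.weylGroup.ofIdx P i)) := by
  obtain ⟨v, hv⟩ := v
  induction hv using RootPairing.weylGroup.induction with
  | one => exact one_mem _
  | mul x y hx hy h1 h2 =>
    have : (⟨x * y, mul_mem hx hy⟩ : P.weylGroup) = ⟨x, hx⟩ * ⟨y, hy⟩ := rfl
    rw [this, map_mul]
    exact mul_mem h1 h2
  | mem i =>
    change ofFinite P (RootPairing.weylGroup.ofIdx P i) ∈ _
    induction i using b.induction_reflect with
    | h₀ i h =>
      rwa [ofIdx_reflectionPerm_same]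
    | h₁ i hi => exact Subgroup.subset_closure ⟨⟨i, hi⟩, rfl⟩
    | h₂ i j h hj =>
      have hs : ofFinite P (RootPairing.weylGroup.ofIdx P j) ∈ Subgroup.closure
          (Set.range fun i : b.support => ofFinite P (RootPairing.weylGroup.ofIdx P i)) :=
        Subgroup.subset_closure ⟨⟨j, hj⟩, rfl⟩
      have := mul_ofIdx P (RootPairing.weylGroup.ofIdx P j) i
      rw [ofIdx_smul_index, ← mul_inv_eq_iff_eq_mul] at this
      rw [← this, map_mul, map_mul, map_inv]
      exact mul_mem (mul_mem hs h) (inv_mem hs)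

variable {b θ}

theorem ofFinite_mem_closure [Finite ι] [P.IsReduced] (v : P.weylGroup) :
    ofFinite P v ∈ Subgroup.closure (Set.range (simpleRefl b θ)) := by
  refine Subgroup.closure_mono ?_ (mem_closure_of_finite b v)
  rintro _ ⟨i, rfl⟩
  exact ⟨some i, rfl⟩

/-- The translations by the orbit of `θ^∨` generate all translations, because `θ^∨` is a short
coroot: `⟨α, β^∨⟩ = ±1` for some `β` in the orbit of `θ` unless `α` is itself in that orbit. -/
theorem translation_coroot_mem_closure [Finite ι] [P.IsReduced] (hirr : IsIrreducibleDatum P)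
    (hθ : IsHighestRoot b θ) (i : ι) :
    translation P (P.coroot i) ∈ Subgroup.closure (Set.range (simpleRefl b θ)) := by
  set H := Subgroup.closure (Set.range (simpleRefl b θ))
  have hfin (v : P.weylGroup) : ofFinite P v ∈ H := ofFinite_mem_closure v
  have hconj {j : ι} (v : P.weylGroup) (hj : translation P (P.coroot j) ∈ H) :
      translation P (P.coroot (v • j)) ∈ H := by
    have : translation P (P.coroot (v • j)) =
        ofFinite P v * translation P (P.coroot j) * (ofFinite P v)⁻¹ := by
      rw [translation, ← coweightAction_coroot, SemidirectProduct.inl_aut, map_inv]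
      rfl
    rw [this]
    exact mul_mem (mul_mem (hfin v) hj) (inv_mem (hfin v))
  have horb (v : P.weylGroup) : translation P (P.coroot (v • θ)) ∈ H := by
    refine hconj v ?_
    have h0 : simpleRefl b θ none ∈ H := Subgroup.subset_closure ⟨none, rfl⟩
    have : translation P (P.coroot θ) =
        simpleRefl b θ none * (ofFinite P (RootPairing.weylGroup.ofIdx P θ))⁻¹ := by
      rw [simpleRefl, mul_inv_cancel_right]
    rw [this]
    exact mul_mem h0 (inv_mem (hfin _))
  -- The roots that are not orthogonal to the whole orbit of `θ` are all the roots.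
  have huniv : {j | ∃ v : P.weylGroup, P.pairing (v • θ) j ≠ 0} = Set.univ := by
    refine hirr.2 _ ⟨θ, 1, by simp⟩ ?_
    rintro j ⟨v, hv⟩ k hk
    simp only [Set.mem_ofPred_eq, not_exists, not_not] at hk
    have h1 := hk v
    have h2 := hk (RootPairing.weylGroup.ofIdx P j * v)
    rw [mul_smul, ofIdx_smul_index, RootPairing.pairing, RootPairing.root', P.root_reflectionPerm,
      P.reflection_apply_root, map_sub, LinearMap.map_smul, LinearMap.sub_apply,
      LinearMap.smul_apply, P.root_coroot_eq_pairing, P.root_coroot_eq_pairing, h1] at h2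
    simpa [hv] using h2
  obtain ⟨v, hv⟩ : i ∈ {j | ∃ v : P.weylGroup, P.pairing (v • θ) j ≠ 0} := huniv ▸ Set.mem_univ i
  obtain ⟨j, rfl⟩ : ∃ j, v • j = i := ⟨v⁻¹ • i, smul_inv_smul v i⟩
  rw [pairing_smul_smul] at hv
  refine hconj v ?_
  by_cases hjθ : j = θ
  · subst hjθ
    simpa using horb 1
  by_cases hjθ' : P.reflectionPerm j j = θ
  · have : translation P (P.coroot j) = (translation P (P.coroot θ))⁻¹ := by
      rw [← hjθ', coroot_reflectionPerm_same, translation, translation, ofAdd_neg, map_inv,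
        inv_inv]
    rw [this]
    simpa using inv_mem (horb 1)
  have hj0 : P.pairing j θ ≠ 0 := fun h => hv (P.pairing_eq_zero_iff'.1 h)
  have hj1 : P.pairing j θ = 1 ∨ P.pairing j θ = -1 := by
    by_cases hp : b.IsPos j
    · have := pairing_highest_nonneg hθ hp
      have := pairing_highest_le_one hθ hjθ
      omega
    · have hp' := (isPos_reflectionPerm_same (b := b) j).2 hp
      have h1 := pairing_highest_nonneg hθ hp'
      have h2 := pairing_highest_le_one hθ hjθ'
      rw [P.pairing_reflectionPerm_self_left] at h1 h2
      omega
  have hr : P.coroot (RootPairing.weylGroup.ofIdx P j • θ) =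
      P.coroot θ - P.pairing j θ • P.coroot j := by
    rw [ofIdx_smul_index, P.coroot_reflectionPerm, P.coreflection_apply_coroot]
  have h1 := horb 1
  have h2 := horb (RootPairing.weylGroup.ofIdx P j)
  rw [one_smul] at h1
  rw [hr] at h2
  have hadd (x y : Y) : translation P (x + y) = translation P x * translation P y := by
    rw [translation, ofAdd_add, map_mul]
    rfl
  rcases hj1 with h | h
  · rw [h, one_smul] at h2
    have := hadd (P.coroot θ - P.coroot j) (P.coroot j)
    rw [sub_add_cancel] at this
    rw [← inv_mul_eq_iff_eq_mul] at this
    rw [← this]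
    exact mul_mem (inv_mem h2) h1
  · rw [h, neg_smul, one_smul, sub_neg_eq_add, hadd] at h2
    simpa using mul_mem (inv_mem h1) h2

theorem closure_range_simpleRefl [Finite ι] [P.IsReduced] (hirr : IsIrreducibleDatum P)
    (hsc : Submodule.span ℤ (Set.range P.coroot) = ⊤) (hθ : IsHighestRoot b θ) :
    Subgroup.closure (Set.range (simpleRefl b θ)) = ⊤ := by
  have htr (y : Y) : translation P y ∈ Subgroup.closure (Set.range (simpleRefl b θ)) := by
    have hy : y ∈ Submodule.span ℤ (Set.range P.coroot) := hsc ▸ Submodule.mem_top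
    rw [← AddSubgroup.toIntSubmodule_closure] at hy
    change y ∈ AddSubgroup.closure _ at hy
    induction hy using AddSubgroup.closure_induction with
    | mem y hy =>
      obtain ⟨i, rfl⟩ := hy
      exact translation_coroot_mem_closure hirr hθ i
    | zero =>
      rw [translation, ofAdd_zero, map_one]
      exact one_mem _
    | add x y _ _ hx hy =>
      rw [translation, ofAdd_add, map_mul]
      exact mul_mem hx hy
    | neg x _ hx =>
      rw [translation, ofAdd_neg, map_inv]
      exact inv_mem hx
  refine eq_top_iff.2 fun w _ => ?_
  rw [← SemidirectProduct.inl_left_mul_inr_right w]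
  exact mul_mem (htr w.left.toAdd) (ofFinite_mem_closure w.right)

theorem exists_wordProd [Finite ι] [P.IsReduced] (hirr : IsIrreducibleDatum P)
    (hsc : Submodule.span ℤ (Set.range P.coroot) = ⊤) (hθ : IsHighestRoot b θ)
    (w : AffineWeyl P) : ∃ ω : List (Node b), (ω.map (simpleRefl b θ)).prod = w := by
  have hw : w ∈ Subgroup.closure (Set.range (simpleRefl b θ)) :=
    closure_range_simpleRefl hirr hsc hθ ▸ Subgroup.mem_top w
  induction hw using Subgroup.closure_induction'' with
  | one => exact ⟨[], rfl⟩
  | mem w hw =>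
    obtain ⟨i, rfl⟩ := hw
    exact ⟨[i], by simp⟩
  | inv_mem w hw =>
    obtain ⟨i, rfl⟩ := hw
    refine ⟨[i], ?_⟩
    have := refl_mul_refl (simpleRoot b θ i)
    rw [← simpleRefl_eq_refl] at this
    simpa using (inv_eq_of_mul_eq_one_right this).symm
  | mul v w _ _ hv hw =>
    obtain ⟨ω, rfl⟩ := hv
    obtain ⟨ω', rfl⟩ := hw
    exact ⟨ω ++ ω', by simp⟩

end Generation

/-- The affine Weyl group, its simple generators and the affine roots. -/
def affineSystem [Finite ι] [P.IsReduced] (hirr : IsIrreducibleDatum P)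
    (hsc : Submodule.span ℤ (Set.range P.coroot) = ⊤) (hθ : IsHighestRoot b θ) :
    ReflectionSystem (AffineWeyl P) (Node b) (AffineRoot P) where
  s := simpleRefl b θ
  root := simpleRoot b θ
  pos := AffineRoot.IsPos b
  s_mul_s i := by rw [simpleRefl_eq_refl, refl_mul_refl]
  pos_root := isPos_simpleRoot
  pos_smul := isPos_simpleRefl_smul hθ
  pos_mul_s_smul g i := by
    rw [mul_smul, simpleRefl_eq_refl, refl_smul_self, smul_neg_root, isPos_neg_iff]
  mul_s_of_smul_root g i j h := by rw [simpleRefl_eq_refl, simpleRefl_eq_refl, mul_refl, h]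
  exists_word := exists_wordProd hirr hsc hθ

end

section

variable {ι X Y : Type*} [AddCommGroup X] [AddCommGroup Y]

/-! ### Divided difference operators on the symmetric algebra -/

/-- A linear map whose values commute pairwise extends to the symmetric algebra. -/
def symLift {A : Type*} [Ring A] (f : X →ₗ[ℤ] A) (hf : ∀ μ ν, f μ * f ν = f ν * f μ) :
    SymmetricAlgebra ℤ X →ₐ[ℤ] A :=
  RingCon.liftₐ (TensorAlgebra.symRingCon ℤ X) (TensorAlgebra.lift ℤ f) <|
    RingCon.ringConGen_le.2 fun x y h => by
      induction h with
      | mul_comm μ ν =>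
        rw [RingCon.ker_apply]
        change TensorAlgebra.lift ℤ f (TensorAlgebra.ι ℤ μ * TensorAlgebra.ι ℤ ν) =
          TensorAlgebra.lift ℤ f (TensorAlgebra.ι ℤ ν * TensorAlgebra.ι ℤ μ)
        have key (κ : X) : TensorAlgebra.lift ℤ f (TensorAlgebra.ι ℤ κ) = f κ :=
          TensorAlgebra.lift_ι_apply f κ
        rw [map_mul, map_mul, key, key, hf]

theorem symLift_ι {A : Type*} [Ring A] (f : X →ₗ[ℤ] A) (hf : ∀ μ ν, f μ * f ν = f ν * f μ)
    (μ : X) : symLift f hf (SymmetricAlgebra.ι ℤ X μ) = f μ :=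
  TensorAlgebra.lift_ι_apply f μ

variable (P : RootDatum ι X Y)

/-- The action of the finite Weyl group on the symmetric algebra of the weight lattice. -/
def symAct (w : P.weylGroup) : SymmetricAlgebra ℤ X →ₐ[ℤ] SymmetricAlgebra ℤ X :=
  SymmetricAlgebra.lift
    (SymmetricAlgebra.ι ℤ X ∘ₗ (DistribSMul.toAddMonoidHom X w).toIntLinearMap)

@[simp]
theorem symAct_ι (w : P.weylGroup) (μ : X) :
    symAct P w (SymmetricAlgebra.ι ℤ X μ) = SymmetricAlgebra.ι ℤ X (w • μ) := by
  rw [symAct, SymmetricAlgebra.lift_ι_apply]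
  rfl

theorem symAct_mul (v w : P.weylGroup) (s : SymmetricAlgebra ℤ X) :
    symAct P (v * w) s = symAct P v (symAct P w s) := by
  have : symAct P (v * w) = (symAct P v).comp (symAct P w) := by
    refine SymmetricAlgebra.algHom_ext (LinearMap.ext fun μ => ?_)
    simp [mul_smul]
  rw [this]
  rfl

theorem evalZero_symAct (w : P.weylGroup) (s : SymmetricAlgebra ℤ X) :
    evalZero (symAct P w s) = evalZero s := by
  have : (evalZero (X := X)).comp (symAct P w) = evalZero := by
    refine SymmetricAlgebra.algHom_ext (LinearMap.ext fun μ => ?_)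
    simp [SymmetricAlgebra.algebraMapInv_ι]
  exact DFunLike.congr_fun this s

/-- The representation `μ ↦ (s_k μ, ⟨μ, α_k^∨⟩; 0, μ)` of `S` by triangular matrices, whose
off-diagonal entry is the divided difference. -/
def demazureMatrix (k : ι) :
    SymmetricAlgebra ℤ X →ₐ[ℤ] Matrix (Fin 2) (Fin 2) (SymmetricAlgebra ℤ X) :=
  symLift
    { toFun := fun μ => !![SymmetricAlgebra.ι ℤ X (P.reflection k μ),
        algebraMap ℤ _ (P.toLinearMap μ (P.coroot k)); 0, SymmetricAlgebra.ι ℤ X μ]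
      map_add' := fun μ ν => by ext i j; fin_cases i <;> fin_cases j <;> simp
      map_smul' := fun n μ => by ext i j; fin_cases i <;> fin_cases j <;> simp }
    fun μ ν => by
      ext i j
      fin_cases i <;> fin_cases j <;>
        simp [Matrix.mul_apply, Fin.sum_univ_two, P.reflection_apply, mul_comm]
      ring

theorem demazureMatrix_ι (k : ι) (μ : X) :
    demazureMatrix P k (SymmetricAlgebra.ι ℤ X μ) = !![SymmetricAlgebra.ι ℤ X (P.reflection k μ),
        algebraMap ℤ _ (P.toLinearMap μ (P.coroot k)); 0, SymmetricAlgebra.ι ℤ X μ] :=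
  symLift_ι _ _ μ

/-- The divided difference operator `s ↦ (s - s_k s) / α_k`. -/
def demazure (k : ι) : SymmetricAlgebra ℤ X →ₗ[ℤ] SymmetricAlgebra ℤ X where
  toFun s := demazureMatrix P k s 0 1
  map_add' s t := by simp
  map_smul' n s := by
    rw [map_smul]
    rfl

theorem demazure_apply (k : ι) (s : SymmetricAlgebra ℤ X) :
    demazure P k s = demazureMatrix P k s 0 1 := rfl

theorem demazureMatrix_eq (k : ι) (s : SymmetricAlgebra ℤ X) :
    demazureMatrix P k s =
      !![symAct P (RootPairing.weylGroup.ofIdx P k) s, demazure P k s; 0, s] := by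
  have h : demazureMatrix P k s 0 0 = symAct P (RootPairing.weylGroup.ofIdx P k) s ∧
      demazureMatrix P k s 1 0 = 0 ∧ demazureMatrix P k s 1 1 = s := by
    induction s using SymmetricAlgebra.induction with
    | algebraMap n =>
      rw [AlgHom.commutes, AlgHom.commutes, Matrix.algebraMap_matrix_apply,
        Matrix.algebraMap_matrix_apply, Matrix.algebraMap_matrix_apply]
      simp
    | ι μ => rw [demazureMatrix_ι, symAct_ι]; simp
    | mul s t hs ht => simp [Matrix.mul_apply, Fin.sum_univ_two, hs, ht]
    | add s t hs ht => simp [hs, ht]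
  ext i j
  fin_cases i <;> fin_cases j <;> simp [h, demazure_apply]

theorem demazure_ι (k : ι) (μ : X) : demazure P k (SymmetricAlgebra.ι ℤ X μ) =
    algebraMap ℤ _ (P.toLinearMap μ (P.coroot k)) := by
  rw [demazure_apply, demazureMatrix_ι]
  rfl

theorem demazure_mul (k : ι) (s t : SymmetricAlgebra ℤ X) : demazure P k (s * t) =
    symAct P (RootPairing.weylGroup.ofIdx P k) s * demazure P k t + demazure P k s * t := by
  rw [demazure_apply, map_mul, demazureMatrix_eq, demazureMatrix_eq]
  simp [Matrix.mul_apply, Fin.sum_univ_two]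

theorem demazure_algebraMap (k : ι) (n : ℤ) :
    demazure P k (algebraMap ℤ (SymmetricAlgebra ℤ X) n) = 0 := by
  rw [demazure_apply, AlgHom.commutes, Matrix.algebraMap_matrix_apply]
  simp

/-! ### The left regular representation -/

section Regular

variable {P} (b : P.Base) (θ : ι)

/-- The index of the finite root `α_i`, with `α_0 = -θ`. -/
abbrev nodeIndex (i : Node b) : ι := (simpleRoot b θ i).index

theorem simpleRefl_right (i : Node b) :
    (simpleRefl b θ i).right = RootPairing.weylGroup.ofIdx P (nodeIndex b θ i) := by
  rw [simpleRefl_eq_refl, refl_right]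

/-- The free module on the affine Weyl group over the symmetric algebra. -/
abbrev RegularModule (P : RootDatum ι X Y) : Type _ := AffineWeyl P →₀ SymmetricAlgebra ℤ X

open Classical in
/-- Left multiplication by `A_i` on `⊕ S A_w`:
`A_i (s A_w) = ∂_i(s) A_w + r_i(s) A_{r_i w}`, where the last term is absent if `r_i w` is shorter
than `w`. -/
def regOp (i : Node b) : Module.End ℤ (RegularModule P) :=
  Finsupp.lsum ℤ fun w => Finsupp.lsingle w ∘ₗ demazure P (nodeIndex b θ i) +
    if len b θ w < len b θ (simpleRefl b θ i * w) then
      Finsupp.lsingle (simpleRefl b θ i * w) ∘ₗ (symAct P (simpleRefl b θ i).right).toLinearMap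
    else 0

theorem simpleRefl_mul_self (i : Node b) : simpleRefl b θ i * simpleRefl b θ i = 1 := by
  rw [simpleRefl_eq_refl, refl_mul_refl]

open Classical in
theorem regOp_apply (i : Node b) (z : RegularModule P) (u : AffineWeyl P) :
    regOp b θ i z u = demazure P (nodeIndex b θ i) (z u) +
      if len b θ (simpleRefl b θ i * u) < len b θ u then
        symAct P (simpleRefl b θ i).right (z (simpleRefl b θ i * u)) else 0 := by
  have hinv (w : AffineWeyl P) : simpleRefl b θ i * (simpleRefl b θ i * w) = w := by
    rw [← mul_assoc, simpleRefl_mul_self, one_mul]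
  induction z using Finsupp.induction_linear with
  | zero => simp
  | add y z hy hz =>
    rw [map_add, Finsupp.add_apply, hy, hz, Finsupp.add_apply, Finsupp.add_apply, map_add, map_add]
    split_ifs <;> ring
  | single w s =>
    rw [regOp, Finsupp.lsum_single, LinearMap.add_apply, Finsupp.add_apply]
    congr 1
    · rw [LinearMap.comp_apply, Finsupp.lsingle_apply, Finsupp.single_apply, Finsupp.single_apply]
      split_ifs <;> simp
    · by_cases hu : w = simpleRefl b θ i * u
      · subst hu
        rw [hinv, Finsupp.single_eq_same]
        split_ifs
        · simp
        · simp
      · have hu' : simpleRefl b θ i * w ≠ u := fun h => hu (by rw [← h, hinv])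
        rw [Finsupp.single_eq_of_ne' hu, map_zero, ite_self]
        split_ifs
        · rw [LinearMap.comp_apply, Finsupp.lsingle_apply, Finsupp.single_eq_of_ne' hu']
        · rfl

theorem regOp_smul (i : Node b) (s : SymmetricAlgebra ℤ X) (z : RegularModule P) :
    regOp b θ i (s • z) = symAct P (simpleRefl b θ i).right s • regOp b θ i z +
      demazure P (nodeIndex b θ i) s • z := by
  classical
  ext u
  rw [Finsupp.add_apply, Finsupp.smul_apply, Finsupp.smul_apply, regOp_apply, regOp_apply,
    Finsupp.smul_apply, Finsupp.smul_apply, smul_eq_mul, smul_eq_mul, smul_eq_mul, smul_eq_mul,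
    demazure_mul, simpleRefl_right]
  split_ifs
  · rw [map_mul]
    ring
  · ring

theorem regOp_single_one (i : Node b) (w : AffineWeyl P) [Decidable (len b θ w <
    len b θ (simpleRefl b θ i * w))] :
    regOp b θ i (Finsupp.single w 1) = if len b θ w < len b θ (simpleRefl b θ i * w) then
      Finsupp.single (simpleRefl b θ i * w) 1 else 0 := by
  have h1 : demazure P (nodeIndex b θ i) 1 = 0 := by
    simpa using demazure_algebraMap P (nodeIndex b θ i) 1
  rw [regOp, Finsupp.lsum_single, LinearMap.add_apply, LinearMap.comp_apply, h1, map_zero, zero_add]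
  split_ifs <;> simp

/-- The operator of a word in the nodes. -/
def regWord (ω : List (Node b)) : Module.End ℤ (RegularModule P) := (ω.map (regOp b θ)).prod

theorem regWord_nil (z : RegularModule P) : regWord b θ [] z = z := rfl

theorem regWord_cons (i : Node b) (ω : List (Node b)) (z : RegularModule P) :
    regWord b θ (i :: ω) z = regOp b θ i (regWord b θ ω z) := by
  simp [regWord]

theorem regWord_append (ω ω' : List (Node b)) (z : RegularModule P) :
    regWord b θ (ω ++ ω') z = regWord b θ ω (regWord b θ ω' z) := by
  simp [regWord]

end Regular

/-- An operator that commutes with scalars up to a twist, and kills the basis, is zero. -/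
theorem eq_zero_of_twisted {P : RootDatum ι X Y} {D : Module.End ℤ (RegularModule P)} (v : P.weylGroup)
    (hD : ∀ (μ : X) z, D (SymmetricAlgebra.ι ℤ X μ • z) =
      symAct P v (SymmetricAlgebra.ι ℤ X μ) • D z)
    (h1 : ∀ w, D (Finsupp.single w 1) = 0) : D = 0 := by
  have key (s : SymmetricAlgebra ℤ X) (z) : D (s • z) = symAct P v s • D z := by
    induction s using SymmetricAlgebra.induction generalizing z with
    | algebraMap n => rw [AlgHom.commutes, algebraMap_smul, algebraMap_smul, map_smul]
    | ι μ => exact hD μ z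
    | mul s t hs ht => rw [mul_smul, hs, ht, map_mul, mul_smul]
    | add s t hs ht => rw [add_smul, map_add, hs, ht, map_add, add_smul]
  refine Finsupp.lhom_ext fun w s => ?_
  rw [← mul_one s, ← smul_eq_mul, ← Finsupp.smul_single, key, h1, smul_zero, LinearMap.zero_apply]

section Representation

variable {P} [Finite ι] [P.IsReduced] {b : P.Base} {θ : ι} (hirr : IsIrreducibleDatum P)
  (hsc : Submodule.span ℤ (Set.range P.coroot) = ⊤) (hθ : IsHighestRoot b θ)

theorem affineSystem_word : (affineSystem hirr hsc hθ).word = wordProd b θ := rfl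

theorem affineSystem_length : (affineSystem hirr hsc hθ).length = len b θ := rfl

theorem affineSystem_s : (affineSystem hirr hsc hθ).s = simpleRefl b θ := rfl

theorem affineSystem_root : (affineSystem hirr hsc hθ).root = simpleRoot b θ := rfl

include hirr hsc hθ

open Classical in
theorem regWord_single_one (ω : List (Node b)) (w : AffineWeyl P) :
    regWord b θ ω (Finsupp.single w 1) =
      if len b θ (wordProd b θ ω * w) = ω.length + len b θ w then
        Finsupp.single (wordProd b θ ω * w) 1 else 0 := by
  induction ω with
  | nil => simp [regWord_nil, wordProd]
  | cons i ω ih =>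
    have hc : wordProd b θ (i :: ω) * w = simpleRefl b θ i * (wordProd b θ ω * w) := by
      simp [wordProd, mul_assoc]
    have h1 := (affineSystem hirr hsc hθ).length_s_mul_le i (wordProd b θ ω * w)
    have h2 := (affineSystem hirr hsc hθ).length_mul_le (wordProd b θ ω) w
    have h3 := (affineSystem hirr hsc hθ).length_word_le ω
    rw [affineSystem_length] at h1 h2 h3
    rw [affineSystem_word] at h3
    rw [affineSystem_s] at h1
    rw [regWord_cons, ih, hc, List.length_cons]
    by_cases h : len b θ (wordProd b θ ω * w) = ω.length + len b θ w
    · rw [if_pos h, regOp_single_one]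
      exact if_congr (by omega) rfl rfl
    · rw [if_neg h, map_zero, if_neg (by omega)]

theorem regOp_mul_self (i : Node b) : regOp b θ i * regOp b θ i = 0 := by
  classical
  refine eq_zero_of_twisted 1 (fun μ z => ?_) fun w => ?_
  · rw [Module.End.mul_apply, Module.End.mul_apply, regOp_smul, map_add, regOp_smul, demazure_ι,
      symAct_ι, symAct_ι, symAct_ι, demazure_ι, algebraMap_smul, algebraMap_smul, (regOp b θ i).map_smul,
      ← mul_smul, simpleRefl_right, ofIdx_mul_self, add_assoc, ← add_smul]
    have : P.toLinearMap (RootPairing.weylGroup.ofIdx P (nodeIndex b θ i) • μ)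
        (P.coroot (nodeIndex b θ i)) + P.toLinearMap μ (P.coroot (nodeIndex b θ i)) = 0 := by
      have h2 := P.root_coroot_two (nodeIndex b θ i)
      rw [ofIdx_smul_weight, map_sub, LinearMap.sub_apply, LinearMap.map_smul,
        LinearMap.smul_apply, h2, smul_eq_mul]
      ring
    rw [this, zero_smul, add_zero]
  · have := regWord_single_one hirr hsc hθ [i, i] w
    rw [if_neg] at this
    · simpa [regWord] using this
    · have : wordProd b θ [i, i] * w = w := by simp [wordProd, simpleRefl_mul_self]
      rw [this]
      simp

theorem regOp_regOp (i : Node b) (z : RegularModule P) : regOp b θ i (regOp b θ i z) = 0 :=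
  LinearMap.congr_fun (regOp_mul_self hirr hsc hθ i) z

/-- The twisted Leibniz rule for an alternating word: only the terms where the first or the last
letter is deleted survive, since every other deletion leaves two equal neighbours. -/
theorem regWord_alternatingWord_smul (i j f : Node b) (m : ℕ)
    (hf : alternatingWord i j (m + 2) = f :: alternatingWord i j (m + 1)) (μ : X)
    (z : RegularModule P) :
    regWord b θ (alternatingWord i j (m + 2)) (SymmetricAlgebra.ι ℤ X μ • z) =
      SymmetricAlgebra.ι ℤ X ((wordProd b θ (alternatingWord i j (m + 2))).right • μ) •
        regWord b θ (alternatingWord i j (m + 2)) z +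
      (P.toLinearMap μ (P.coroot (nodeIndex b θ j)) •
        regWord b θ (alternatingWord j i (m + 1)) z +
      P.toLinearMap ((wordProd b θ (alternatingWord i j (m + 1))).right • μ)
        (P.coroot (nodeIndex b θ f)) • regWord b θ (alternatingWord i j (m + 1)) z) := by
  have hlast (i j : Node b) (m : ℕ) (z : RegularModule P) :
      regWord b θ (alternatingWord i j (m + 1)) z =
        regWord b θ (alternatingWord j i m) (regOp b θ j z) := by
    rw [alternatingWord_succ, List.concat_eq_append, regWord_append, regWord_cons, regWord_nil]
  have hword (i j : Node b) (m : ℕ) (μ : X) :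
      (wordProd b θ (alternatingWord i j (m + 1))).right • μ =
        (wordProd b θ (alternatingWord j i m)).right • (simpleRefl b θ j).right • μ := by
    rw [← mul_smul, ← SemidirectProduct.mul_right]
    simp [alternatingWord_succ, wordProd]
  induction m generalizing i j μ z with
  | zero =>
    obtain rfl : f = i := by simpa [alternatingWord, eq_comm] using hf
    simp only [alternatingWord, List.concat_eq_append, List.nil_append, List.cons_append,
      regWord_cons, regWord_nil, regOp_smul, map_add, demazure_ι, symAct_ι, algebraMap_smul,
      map_smul, wordProd, List.map_cons, List.map_nil, List.prod_cons, List.prod_nil, mul_one,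
      SemidirectProduct.mul_right, mul_smul]
    abel
  | succ m ih =>
    have hf' : alternatingWord j i (m + 2) = f :: alternatingWord j i (m + 1) := by
      rw [alternatingWord_succ i j (m + 2), alternatingWord_succ i j (m + 1),
        List.concat_eq_append, List.concat_eq_append, ← List.cons_append] at hf
      exact List.append_cancel_right hf
    rw [hlast i j (m + 2), hlast i j (m + 2), regOp_smul, symAct_ι, demazure_ι, algebraMap_smul,
      map_add, (regWord b θ _).map_smul, ih j i hf', hword i j (m + 2), hword i j (m + 1), ← hlast i j (m + 1),
      hlast i j m, regOp_regOp hirr hsc hθ, map_zero, smul_zero, zero_add, add_assoc,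
      add_comm (_ • _) (_ • regWord b θ (alternatingWord j i (m + 2)) z)]

theorem regOp_braid (i j : Node b) (m : ℕ)
    (hr : (affineSystem hirr hsc hθ).Reduced (alternatingWord i j m))
    (hw : (affineSystem hirr hsc hθ).word (alternatingWord i j m) =
      (affineSystem hirr hsc hθ).word (alternatingWord j i m)) :
    ((alternatingWord i j m).map (regOp b θ)).prod =
      ((alternatingWord j i m).map (regOp b θ)).prod := by
  classical
  have hr' := hr.congr hw (by rw [length_alternatingWord, length_alternatingWord])
  rcases m with _ | _ | m
  · rfl
  · have h : (affineSystem hirr hsc hθ).s j = (affineSystem hirr hsc hθ).s i := by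
      simpa [alternatingWord] using hw
    rw [simpleRoot_injective (ReflectionSystem.root_eq_of_s_eq h)]
  rw [← sub_eq_zero]
  have hfirst (i j : Node b) : ∃ f, alternatingWord i j (m + 2) = f :: alternatingWord i j (m + 1) :=
    ⟨_, CoxeterSystem.alternatingWord_succ' i j (m + 1)⟩
  -- Reducedness gives `σ α_i = α_f`, so that the two boundary terms agree.
  have hcoroot (i j f : Node b)
      (hr : (affineSystem hirr hsc hθ).Reduced (alternatingWord j i (m + 2)))
      (hw : (affineSystem hirr hsc hθ).word (alternatingWord i j (m + 2)) =
        (affineSystem hirr hsc hθ).word (alternatingWord j i (m + 2)))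
      (hf : alternatingWord i j (m + 2) = f :: alternatingWord i j (m + 1)) (μ : X) :
      P.toLinearMap ((wordProd b θ (alternatingWord i j (m + 1))).right • μ)
        (P.coroot (nodeIndex b θ f)) = P.toLinearMap μ (P.coroot (nodeIndex b θ i)) := by
    rw [hf, alternatingWord_succ j i, List.concat_eq_append] at hw
    rw [alternatingWord_succ j i, List.concat_eq_append] at hr
    have := congrArg AffineRoot.index (hr.word_smul_root hw)
    rw [affineSystem_root, smul_index] at this
    change _ = nodeIndex b θ f at this
    rw [← this]
    exact pairing_smul_coroot P _ _ _
  obtain ⟨f, hf⟩ := hfirst i j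
  obtain ⟨f', hf'⟩ := hfirst j i
  refine eq_zero_of_twisted (wordProd b θ (alternatingWord i j (m + 2))).right
    (fun μ z => ?_) fun w => ?_
  · change regWord b θ _ _ - regWord b θ _ _ = _ • (regWord b θ _ _ - regWord b θ _ _)
    rw [regWord_alternatingWord_smul hirr hsc hθ i j f m hf,
      regWord_alternatingWord_smul hirr hsc hθ j i f' m hf', hcoroot i j f hr' hw hf,
      hcoroot j i f' hr hw.symm hf', symAct_ι, smul_sub]
    rw [affineSystem_word] at hw
    rw [hw]
    abel
  · change regWord b θ _ _ - regWord b θ _ _ = _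
    rw [affineSystem_word] at hw
    rw [regWord_single_one hirr hsc hθ, regWord_single_one hirr hsc hθ, hw, length_alternatingWord,
      length_alternatingWord, sub_self]

end Representation

end

section

variable {ι X Y : Type*} [AddCommGroup X] [AddCommGroup Y]
  {P : RootDatum ι X Y} {b : P.Base} {θ : ι}
  (hirr : IsIrreducibleDatum P)
  (hsc : Submodule.span ℤ (Set.range P.coroot) = ⊤) (hθ : IsHighestRoot b θ)

/-! ### The nilHecke ring and its regular representation -/

theorem genA_mul_self (i : Node b) : genA b θ i * genA b θ i = 0 := by
  rw [genA, ← map_mul, RingQuot.mkAlgHom_rel ℤ (Rel.nil i), map_zero]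

theorem prod_map_genA (ω : List (Node b)) :
    (ω.map (genA b θ)).prod = RingQuot.mkAlgHom ℤ (Rel b θ) (ω.map (symA b)).prod := by
  rw [map_list_prod, List.map_map]
  rfl

theorem genA_braid (i j : Node b) (m : ℕ)
    (hw : wordProd b θ (alternatingWord i j m) = wordProd b θ (alternatingWord j i m)) :
    ((alternatingWord i j m).map (genA b θ)).prod =
      ((alternatingWord j i m).map (genA b θ)).prod := by
  rw [prod_map_genA, prod_map_genA]
  exact RingQuot.mkAlgHom_rel ℤ (Rel.braid i j m hw)

variable [Finite ι] [P.IsReduced]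

include hirr hsc hθ in
theorem prod_map_regOp_alternatingWord (i j : Node b) (m : ℕ)
    (hw : wordProd b θ (alternatingWord i j m) = wordProd b θ (alternatingWord j i m)) :
    ((alternatingWord i j m).map (regOp b θ)).prod =
      ((alternatingWord j i m).map (regOp b θ)).prod := by
  have hl : (alternatingWord i j m).length = (alternatingWord j i m).length := by
    rw [length_alternatingWord, length_alternatingWord]
  by_cases hr : (affineSystem hirr hsc hθ).Reduced (alternatingWord i j m)
  · exact regOp_braid hirr hsc hθ i j m hr hw
  · have hr' : ¬ (affineSystem hirr hsc hθ).Reduced (alternatingWord j i m) :=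
      fun h => hr (h.congr hw.symm hl.symm)
    rw [ReflectionSystem.prod_map_eq_zero_of_not_reduced _ _ (regOp_mul_self hirr hsc hθ)
      (regOp_braid hirr hsc hθ) hr, ReflectionSystem.prod_map_eq_zero_of_not_reduced _ _
      (regOp_mul_self hirr hsc hθ) (regOp_braid hirr hsc hθ) hr']

/-- The left regular representation of the affine nilHecke ring. -/
def regRep : NilHecke b θ →ₐ[ℤ] Module.End ℤ (RegularModule P) :=
  RingQuot.liftAlgHom ℤ ⟨FreeAlgebra.lift ℤ (Sum.elim (regOp b θ)
    fun μ => Algebra.lsmul ℤ ℤ (RegularModule P) (SymmetricAlgebra.ι ℤ X μ)), by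
    intro x y h
    induction h with
    | add μ ν => simp
    | comm μ ν =>
      rw [map_mul, map_mul, FreeAlgebra.lift_ι_apply, FreeAlgebra.lift_ι_apply, Sum.elim_inr,
        Sum.elim_inr, ← map_mul, mul_comm, map_mul]
    | leibniz i μ =>
      refine LinearMap.ext fun z => ?_
      simp only [symA, symWt, map_mul, map_add, FreeAlgebra.lift_ι_apply, Sum.elim_inl,
        Sum.elim_inr, AlgHom.commutes, Module.End.mul_apply, LinearMap.add_apply,
        Algebra.lsmul_coe, Module.algebraMap_end_apply, regOp_smul, symAct_ι, demazure_ι,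
        algebraMap_smul, simpleCoroot_eq]
      rfl
    | nil i => simp [regOp_mul_self hirr hsc hθ]
    | braid i j m h =>
      rw [map_list_prod, map_list_prod, List.map_map, List.map_map]
      have hc : (⇑(FreeAlgebra.lift ℤ (Sum.elim (regOp b θ) fun μ =>
          Algebra.lsmul ℤ ℤ (RegularModule P) (SymmetricAlgebra.ι ℤ X μ))) ∘ symA b) =
          regOp b θ := by
        ext1 i
        simp
      rw [hc]
      exact prod_map_regOp_alternatingWord hirr hsc hθ i j m h⟩

theorem regRep_genA (i : Node b) : regRep hirr hsc hθ (genA b θ i) = regOp b θ i := by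
  rw [regRep, genA, RingQuot.liftAlgHom_mkAlgHom_apply]
  simp

theorem regRep_weight (μ : X) (z : RegularModule P) :
    regRep hirr hsc hθ (weight b θ μ) z = SymmetricAlgebra.ι ℤ X μ • z := by
  change regRep hirr hsc hθ (RingQuot.mkAlgHom ℤ (Rel b θ) (symWt b μ)) z = _
  rw [regRep, RingQuot.liftAlgHom_mkAlgHom_apply]
  simp

theorem regRep_scalar (s : SymmetricAlgebra ℤ X) (z : RegularModule P) :
    regRep hirr hsc hθ (scalar b θ s) z = s • z := by
  induction s using SymmetricAlgebra.induction generalizing z with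
  | algebraMap n =>
    rw [AlgHom.commutes, AlgHom.commutes, Module.algebraMap_end_apply, algebraMap_smul]
  | ι μ => rw [scalar_ι, regRep_weight]
  | mul s t hs ht => rw [map_mul, map_mul, Module.End.mul_apply, ht, hs, mul_smul]
  | add s t hs ht => rw [map_add, map_add, LinearMap.add_apply, ht, hs, add_smul]

theorem regRep_prod (ω : List (Node b)) :
    regRep hirr hsc hθ (ω.map (genA b θ)).prod = regWord b θ ω := by
  rw [map_list_prod, List.map_map, regWord]
  congr 2
  ext1 i
  exact regRep_genA hirr hsc hθ i

include hirr hsc hθ in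
/-- `A_w` may be computed from any reduced word for `w`. -/
theorem basisA_wordProd {ω : List (Node b)} (h : (affineSystem hirr hsc hθ).Reduced ω) :
    basisA b θ (wordProd b θ ω) = (ω.map (genA b θ)).prod := by
  have hε : IsReducedWord b θ (wordProd b θ ω)
      (Classical.epsilon (IsReducedWord b θ (wordProd b θ ω))) :=
    Classical.epsilon_spec (p := IsReducedWord b θ (wordProd b θ ω)) ⟨ω, rfl, h.symm⟩
  refine (affineSystem hirr hsc hθ).prod_map_eq_of_reduced (genA b θ)
    (fun i j m _ hw => genA_braid i j m hw) ?_ h hε.1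
  refine h.congr hε.1.symm ?_
  rw [hε.2]
  exact h.symm

theorem regRep_basisA_single_one (w : AffineWeyl P) :
    regRep hirr hsc hθ (basisA b θ w) (Finsupp.single 1 1) = Finsupp.single w 1 := by
  classical
  obtain ⟨ω, rfl, hl⟩ := (affineSystem hirr hsc hθ).exists_reduced w
  have h1 : len b θ (1 : AffineWeyl P) = 0 := (affineSystem hirr hsc hθ).length_one
  have h2 : len b θ (wordProd b θ ω) = ω.length := hl.symm
  rw [affineSystem_word, basisA_wordProd hirr hsc hθ hl.symm, regRep_prod,
    regWord_single_one hirr hsc hθ, mul_one, h1, h2, if_pos (by simp)]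

/-- Applied to the generator of the regular module, an `S`-linear combination of the `A_w` gives
back its coefficients; in particular the `A_w` are linearly independent over `S`. -/
theorem regRep_expansion (c : AffineWeyl P →₀ SymmetricAlgebra ℤ X) :
    regRep hirr hsc hθ (expansion b θ c) (Finsupp.single 1 1) = c := by
  rw [expansion, Finsupp.sum, map_sum, LinearMap.sum_apply]
  conv_rhs => rw [← Finsupp.sum_single c]
  refine Finset.sum_congr rfl fun w _ => ?_
  rw [map_mul, Module.End.mul_apply, regRep_basisA_single_one, regRep_scalar,
    Finsupp.smul_single, smul_eq_mul, mul_one]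

theorem regRep_intExpansion (c : AffineWeyl P →₀ ℤ) (s : SymmetricAlgebra ℤ X) :
    regRep hirr hsc hθ (intExpansion b θ c) (Finsupp.single 1 s) =
      c.sum fun w n => n • regRep hirr hsc hθ (basisA b θ w) (Finsupp.single 1 s) := by
  rw [intExpansion, Finsupp.sum, map_sum, LinearMap.sum_apply]
  refine Finset.sum_congr rfl fun w _ => ?_
  rw [map_zsmul, LinearMap.smul_apply]

theorem regRep_intExpansion_one (c : AffineWeyl P →₀ ℤ) :
    regRep hirr hsc hθ (intExpansion b θ c) (Finsupp.single 1 1) =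
      c.mapRange (algebraMap ℤ (SymmetricAlgebra ℤ X)) (map_zero _) := by
  rw [regRep_intExpansion]
  conv_rhs => rw [← Finsupp.sum_single c]
  rw [Finsupp.sum, Finsupp.sum, Finsupp.mapRange_finsetSum
    (algebraMap ℤ (SymmetricAlgebra ℤ X)) ]
  refine Finset.sum_congr rfl fun w _ => ?_
  rw [regRep_basisA_single_one, Finsupp.smul_single, Finsupp.mapRange_single, Algebra.smul_def,
    mul_one]

include hirr hsc hθ in
theorem intExpansion_injective : Function.Injective (intExpansion b θ) := by
  intro c c' h
  have h' := regRep_intExpansion_one hirr hsc hθ c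
  rw [h, regRep_intExpansion_one] at h'
  exact (Finsupp.mapRange_injective _ _ (SymmetricAlgebra.algebraMap_leftInverse X).injective
    h').symm

include hirr hsc hθ in
/-- The `A_w` span the affine nilCoxeter algebra over `ℤ`. -/
theorem exists_intExpansion_of_mem_nilCoxeter {a : NilHecke b θ} (ha : a ∈ nilCoxeter b θ) :
    ∃ c, a = intExpansion b θ c := by
  suffices h : a ∈ Submodule.span ℤ (Set.range (basisA b θ)) by
    rw [← Finsupp.range_linearCombination] at h
    exact h.imp fun c hc => hc.symm
  rw [nilCoxeter, ← Subalgebra.mem_toSubmodule, Algebra.adjoin_eq_span] at ha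
  refine Submodule.span_le.2 ?_ ha
  intro x hx
  obtain ⟨l, hl, rfl⟩ := Submonoid.exists_list_of_mem_closure hx
  obtain ⟨ω, rfl⟩ : ∃ ω : List (Node b), ω.map (genA b θ) = l := by
    rw [← Set.mem_range, Set.range_list_map]
    exact hl
  by_cases hr : (affineSystem hirr hsc hθ).Reduced ω
  · rw [← basisA_wordProd hirr hsc hθ hr]
    exact Submodule.subset_span ⟨_, rfl⟩
  · rw [(affineSystem hirr hsc hθ).prod_map_eq_zero_of_not_reduced (genA b θ) genA_mul_self
      (fun i j m _ hw => genA_braid i j m hw) hr]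
    exact zero_mem _

include hirr hsc hθ in
/-- The condition `φ₀(a s) = φ₀(s) a`, read off in the regular representation. -/
theorem evalZero_regRep_of_mem_fominStanley {c : AffineWeyl P →₀ ℤ}
    (h : intExpansion b θ c ∈ fominStanley b θ) (s : SymmetricAlgebra ℤ X) (w : AffineWeyl P) :
    evalZero (regRep hirr hsc hθ (intExpansion b θ c) (Finsupp.single 1 s) w) =
      evalZero s * c w := by
  obtain ⟨d, hd, hd'⟩ := h.2 s
  have h1 : regRep hirr hsc hθ (intExpansion b θ c) (Finsupp.single 1 s) = d := by
    rw [← regRep_expansion hirr hsc hθ d, ← hd, map_mul, Module.End.mul_apply, regRep_scalar,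
      Finsupp.smul_single, smul_eq_mul, mul_one]
  have h2 : intExpansion b θ (evalZero s • c) = evalZero s • intExpansion b θ c :=
    (Finsupp.linearCombination ℤ (basisA b θ)).map_smul _ _
  rw [← h2] at hd'
  have h3 := intExpansion_injective hirr hsc hθ hd'
  have := DFunLike.congr_fun h3 w
  rw [h1]
  simpa using this.symm

end

section

variable {ι X Y : Type*} [AddCommGroup X] [AddCommGroup Y] {P : RootDatum ι X Y}

/-! ### Divided differences of powers of a regular dominant weight -/

section Words

variable (b : P.Base) (θ : ι)

/-- The composite of divided difference operators along a word. -/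
def demWord (ω : List (Node b)) : Module.End ℤ (SymmetricAlgebra ℤ X) :=
  (ω.map fun i => demazure P (nodeIndex b θ i)).prod

theorem demWord_nil (s : SymmetricAlgebra ℤ X) : demWord b θ [] s = s := rfl

theorem demWord_cons (i : Node b) (ω : List (Node b)) (s : SymmetricAlgebra ℤ X) :
    demWord b θ (i :: ω) s = demazure P (nodeIndex b θ i) (demWord b θ ω s) := by
  simp [demWord]

theorem demWord_append (ω ω' : List (Node b)) (s : SymmetricAlgebra ℤ X) :
    demWord b θ (ω ++ ω') s = demWord b θ ω (demWord b θ ω' s) := by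
  simp [demWord]

theorem len_one : len b θ (1 : AffineWeyl P) = 0 :=
  Nat.le_zero.1 (Nat.sInf_le ⟨[], rfl, rfl⟩)

theorem regWord_apply_one (ω : List (Node b)) (z : RegularModule P) :
    regWord b θ ω z 1 = demWord b θ ω (z 1) := by
  classical
  induction ω with
  | nil => rfl
  | cons i ω ih =>
    rw [regWord_cons, demWord_cons, regOp_apply, ih, len_one, if_neg (Nat.not_lt_zero _), add_zero]

/-- The nodes other than `0`. -/
abbrev finiteNodes (b : P.Base) : Set (Node b) := Set.range some

variable {b} in
theorem wordProd_of_finiteNodes {ω : List (Node b)} (hω : ∀ i ∈ ω, i ∈ finiteNodes b) :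
    ∃ v, wordProd b θ ω = ofFinite P v := by
  induction ω with
  | nil => exact ⟨1, by simp [wordProd]⟩
  | cons i ω ih =>
    obtain ⟨v, hv⟩ := ih fun j hj => hω j (by simp [hj])
    obtain ⟨j, rfl⟩ := hω i (by simp)
    refine ⟨RootPairing.weylGroup.ofIdx P j * v, ?_⟩
    rw [map_mul, ← hv]
    simp [wordProd, simpleRefl]

theorem exists_finite_word [Finite ι] [P.IsReduced] (v : P.weylGroup) :
    ∃ ω : List (Node b), (∀ i ∈ ω, i ∈ finiteNodes b) ∧ wordProd b θ ω = ofFinite P v := by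
  have hv := mem_closure_of_finite b v
  generalize ofFinite P v = w at hv
  induction hv using Subgroup.closure_induction'' with
  | one => exact ⟨[], by simp [wordProd]⟩
  | mem w hw =>
    obtain ⟨i, rfl⟩ := hw
    exact ⟨[some i], by simp, by simp [wordProd, simpleRefl]⟩
  | inv_mem w hw =>
    obtain ⟨i, rfl⟩ := hw
    refine ⟨[some i], by simp, ?_⟩
    rw [← map_inv, inv_eq_of_mul_eq_one_right (ofIdx_mul_self P i)]
    simp [wordProd, simpleRefl]
  | mul v w _ _ hv hw =>
    obtain ⟨ω, h, rfl⟩ := hv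
    obtain ⟨ω', h', rfl⟩ := hw
    refine ⟨ω ++ ω', fun i hi => ?_, by simp [wordProd]⟩
    exact (List.mem_append.1 hi).elim (h i) (h' i)

end Words

section Finite

theorem ofFinite_smul_isPos {b : P.Base} (v : P.weylGroup) (k : ι) :
    (ofFinite P v • (⟨k, 0⟩ : AffineRoot P)).IsPos b ↔ b.IsPos (v • k) := by
  have h1 : (ofFinite P v • (⟨k, 0⟩ : AffineRoot P)).level = 0 := by
    rw [smul_level]
    change 0 - P.toLinearMap _ (0 : Y) = 0
    simp
  rw [AffineRoot.IsPos, h1]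
  simp only [lt_self_iff_false, true_and, false_or]
  rfl

variable (P) in
theorem finite_weylGroup [Finite ι] (hsc : Submodule.span ℤ (Set.range P.coroot) = ⊤) :
    Finite P.weylGroup := by
  refine Finite.of_injective P.weylGroupToPerm ?_
  rw [injective_iff_map_eq_one]
  intro w hw
  have hi (i : ι) : w • i = i := Equiv.congr_fun hw i
  refine weylGroup_ext P fun μ => ?_
  have hinj : Function.Injective P.toLinearMap := P.toPerfPair.injective
  apply hinj
  refine LinearMap.ext_on_range (v := P.coroot) hsc fun i => ?_
  have := pairing_smul_coroot P w μ i
  rwa [hi] at this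

theorem flip_isPos_iff [Finite ι] [P.IsReduced] [P.flip.IsReduced] {b : P.Base} (i : ι) :
    b.flip.IsPos i ↔ b.IsPos i := by
  induction i using b.induction_reflect with
  | h₀ i h =>
    have h1 := isPos_reflectionPerm_same (b := b) i
    have h2 := isPos_reflectionPerm_same (P := P.flip) (b := b.flip) i
    rw [h1, ← h]
    exact h2
  | h₁ i hi =>
    exact iff_of_true (RootPairing.Base.isPos_of_mem_support (b := b.flip) hi)
      (RootPairing.Base.isPos_of_mem_support hi)
  | h₂ i j h hj =>
    by_cases hij : i = j
    · subst hij
      have h1 := isPos_reflectionPerm_same (b := b) i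
      have h2 := isPos_reflectionPerm_same (P := P.flip) (b := b.flip) i
      rw [h1, ← h]
      exact h2
    by_cases hij' : P.reflectionPerm j i = j
    · rw [hij']
      exact iff_of_true (RootPairing.Base.isPos_of_mem_support (b := b.flip) hj)
        (RootPairing.Base.isPos_of_mem_support hj)
    have h1 : b.IsPos (P.reflectionPerm j i) ↔ b.IsPos i :=
      ⟨fun hp => by simpa using hp.reflectionPerm hj hij', fun hp => hp.reflectionPerm hj hij⟩
    have h2 : b.flip.IsPos (P.reflectionPerm j i) ↔ b.flip.IsPos i :=
      ⟨fun hp => by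
        have := RootPairing.Base.IsPos.reflectionPerm (P := P.flip) (b := b.flip) hp hj hij'
        simpa using this,
      fun hp => RootPairing.Base.IsPos.reflectionPerm (P := P.flip) (b := b.flip) hp hj hij⟩
    rw [h1, h2, h]

/-- There is a weight pairing positively with all positive coroots. -/
theorem exists_regular_dominant [Finite ι] [P.IsReduced]
    (hsc : Submodule.span ℤ (Set.range P.coroot) = ⊤) (b : P.Base) :
    ∃ μ : X, ∀ i, b.IsPos i → 0 < P.toLinearMap μ (P.coroot i) := by
  have : Module.IsReflexive ℤ X := .of_isPerfPair P.toLinearMap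
  have : Module.IsReflexive ℤ Y := .of_isPerfPair P.flip.toLinearMap
  let B : Module.Basis b.support ℤ Y := Module.Basis.mk b.linearIndepOn_coroot (by
    have h := b.span_int_coroot_support
    rw [hsc, Set.image_eq_range] at h
    exact h.ge)
  obtain ⟨μ, hμ⟩ := P.toPerfPair.surjective (B.constr ℤ fun _ => (1 : ℤ))
  have hμ' (y : Y) : P.toLinearMap μ y = B.constr ℤ (fun _ => (1 : ℤ)) y :=
    LinearMap.congr_fun hμ y
  refine ⟨μ, fun i hi => ?_⟩
  rw [← flip_isPos_iff, b.flip.isPos_iff] at hi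
  obtain ⟨f, -, -, hf⟩ := b.flip.exists_root_eq_sum_int i
  rw [RootPairing.Base.height_eq_sum hf] at hi
  have hf' : P.coroot i = ∑ j ∈ b.support, f j • P.coroot j := hf
  rw [hf', map_sum]
  refine lt_of_lt_of_eq hi (Finset.sum_congr rfl fun j hj => ?_)
  have hB : B ⟨j, hj⟩ = P.coroot j := Module.Basis.mk_apply _ _ _
  rw [map_smul, hμ', ← hB, Module.Basis.constr_basis]
  simp

end Finite

section Regular

variable [Finite ι] [P.IsReduced] {b : P.Base} {θ : ι} (hirr : IsIrreducibleDatum P)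
  (hsc : Submodule.span ℤ (Set.range P.coroot) = ⊤) (hθ : IsHighestRoot b θ)

/-- The twisted Leibniz rule along a word. The coefficients are pairings of `μ` with the coroots
of the inversions of the word, hence positive for reduced finite words and `μ` regular dominant. -/
theorem demWord_ι_mul (μ : X) (hμ : ∀ i, b.IsPos i → 0 < P.toLinearMap μ (P.coroot i))
    (ω : List (Node b)) :
    ∃ c : ℕ → ℤ, (∀ s, demWord b θ ω (SymmetricAlgebra.ι ℤ X μ * s) =
      SymmetricAlgebra.ι ℤ X ((wordProd b θ ω).right • μ) * demWord b θ ω s +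
        ∑ k ∈ Finset.range ω.length, c k • demWord b θ (ω.eraseIdx k) s) ∧
      ((affineSystem hirr hsc hθ).Reduced ω → (∀ i ∈ ω, i ∈ finiteNodes b) →
        ∀ k < ω.length, 0 < c k) := by
  induction ω with
  | nil => exact ⟨0, by simp [demWord_nil, wordProd], by simp⟩
  | cons i ω ih =>
    obtain ⟨c, hc, hpos⟩ := ih
    refine ⟨fun k => Nat.casesOn k
      (P.toLinearMap ((wordProd b θ ω).right • μ) (P.coroot (nodeIndex b θ i))) c,
      fun s => ?_, fun hr hJ k hk => ?_⟩
    · rw [demWord_cons, hc, map_add, demazure_mul, demazure_ι, symAct_ι, map_sum, List.length_cons,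
        Finset.sum_range_succ', add_assoc, ← demWord_cons, ← simpleRefl_right, ← mul_smul,
        ← SemidirectProduct.mul_right, ← Algebra.smul_def]
      congr 1
      rw [add_comm]
      congr 1
      refine Finset.sum_congr rfl fun k _ => ?_
      rw [List.eraseIdx_cons_succ, demWord_cons, LinearMap.map_smul]
    · rcases k with _ | k
      · -- The inverse of `ω` sends `α_i` to a positive root.
        have hr' : (affineSystem hirr hsc hθ).Reduced (ω.reverse ++ [i]) := by
          rw [← List.reverse_cons]
          unfold ReflectionSystem.Reduced at hr ⊢
          rw [ReflectionSystem.word_reverse, ReflectionSystem.length_inv, hr, List.length_reverse]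
        have hp := ((ReflectionSystem.reduced_concat_iff _ _ _).1 hr').2
        obtain ⟨v, hv⟩ := wordProd_of_finiteNodes θ fun j hj => hJ j (List.mem_cons_of_mem i hj)
        obtain ⟨j, rfl⟩ := hJ i List.mem_cons_self
        rw [ReflectionSystem.word_reverse, affineSystem_word, hv, ← map_inv] at hp
        have hp' := (ofFinite_smul_isPos v⁻¹ (j : ι)).1 hp
        have := hμ _ hp'
        rw [← pairing_smul_coroot P v, smul_inv_smul] at this
        rw [hv]
        exact this
      · exact hpos (ReflectionSystem.Reduced.of_append (ω := [i]) hr).2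
          (fun j hj => hJ j (List.mem_cons_of_mem i hj)) k (by simpa using hk)

include hirr hsc hθ in
theorem demWord_eq_zero_of_not_reduced {ω : List (Node b)}
    (h : ¬ (affineSystem hirr hsc hθ).Reduced ω) (s : SymmetricAlgebra ℤ X) :
    demWord b θ ω s = 0 := by
  have h0 : regWord b θ ω = 0 :=
    ReflectionSystem.prod_map_eq_zero_of_not_reduced _ _ (regOp_mul_self hirr hsc hθ)
      (regOp_braid hirr hsc hθ) h
  have h1 := regWord_apply_one b θ ω (Finsupp.single 1 s)
  rwa [h0, Finsupp.single_eq_same, LinearMap.zero_apply, Finsupp.zero_apply, eq_comm] at h1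

theorem evalZero_ι_mul (μ : X) (s : SymmetricAlgebra ℤ X) :
    evalZero (SymmetricAlgebra.ι ℤ X μ * s) = 0 := by
  rw [map_mul, SymmetricAlgebra.algebraMapInv_ι, zero_mul]

include hirr hsc hθ in
/-- Divided differences lower degrees by one. -/
theorem evalZero_demWord_pow_of_ne (μ : X)
    (hμ : ∀ i, b.IsPos i → 0 < P.toLinearMap μ (P.coroot i)) (k : ℕ) (ω : List (Node b))
    (h : ω.length ≠ k) : evalZero (demWord b θ ω (SymmetricAlgebra.ι ℤ X μ ^ k)) = 0 := by
  induction k generalizing ω with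
  | zero =>
    rcases List.eq_nil_or_concat' ω with rfl | ⟨ω, i, rfl⟩
    · exact absurd rfl h
    · have h1 : demazure P (nodeIndex b θ i) 1 = 0 := by
        simpa using demazure_algebraMap P (nodeIndex b θ i) 1
      rw [pow_zero, demWord_append, demWord_cons, demWord_nil, h1, map_zero, map_zero]
  | succ k ih =>
    obtain ⟨c, hc, -⟩ := demWord_ι_mul hirr hsc hθ μ hμ ω
    rw [pow_succ', hc, map_add, evalZero_ι_mul, map_sum, zero_add]
    refine Finset.sum_eq_zero fun l hl => ?_
    rw [Finset.mem_range] at hl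
    rw [map_zsmul, ih _ (by rw [List.length_eraseIdx_of_lt hl]; omega), smul_zero]

theorem evalZero_demWord_pow_pos (μ : X)
    (hμ : ∀ i, b.IsPos i → 0 < P.toLinearMap μ (P.coroot i)) (k : ℕ) (ω : List (Node b))
    (h : ω.length = k) (hr : (affineSystem hirr hsc hθ).Reduced ω)
    (hJ : ∀ i ∈ ω, i ∈ finiteNodes b) :
    0 < evalZero (demWord b θ ω (SymmetricAlgebra.ι ℤ X μ ^ k)) := by
  induction k generalizing ω with
  | zero =>
    rw [List.length_eq_zero_iff] at h
    rw [h, pow_zero, demWord_nil, map_one]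
    exact one_pos
  | succ k ih =>
    obtain ⟨c, hc, hpos⟩ := demWord_ι_mul hirr hsc hθ μ hμ ω
    rw [pow_succ', hc, map_add, evalZero_ι_mul, map_sum, zero_add]
    have hJ' (l : ℕ) : ∀ i ∈ ω.eraseIdx l, i ∈ finiteNodes b :=
      fun i hi => hJ i (List.mem_of_mem_eraseIdx hi)
    have hl' (l : ℕ) (hl : l < ω.length) : (ω.eraseIdx l).length = k := by
      rw [List.length_eraseIdx_of_lt hl]; omega
    refine Finset.sum_pos' (fun l hl => ?_) ⟨0, by simp [h], ?_⟩
    · rw [Finset.mem_range] at hl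
      rw [map_zsmul, smul_eq_mul]
      refine mul_nonneg (hpos hr hJ l hl).le ?_
      by_cases hrl : (affineSystem hirr hsc hθ).Reduced (ω.eraseIdx l)
      · exact (ih _ (hl' l hl) hrl (hJ' l)).le
      · rw [demWord_eq_zero_of_not_reduced hirr hsc hθ hrl, map_zero]
    · have h0 : 0 < ω.length := by omega
      rw [map_zsmul, smul_eq_mul]
      refine mul_pos (hpos hr hJ 0 h0) (ih _ (hl' 0 h0) ?_ (hJ' 0))
      rcases ω with _ | ⟨i, ω⟩
      · simp at h
      · exact (ReflectionSystem.Reduced.of_append (ω := [i]) hr).2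

end Regular

/-! ### Longest elements and the dual basis -/

section Longest

variable [Finite ι] [P.IsReduced] {b : P.Base} {θ : ι} (hirr : IsIrreducibleDatum P)
  (hsc : Submodule.span ℤ (Set.range P.coroot) = ⊤) (hθ : IsHighestRoot b θ)

include hirr hsc hθ

theorem isGrassmannian_iff (u : AffineWeyl P) :
    IsGrassmannian b θ u ↔ (affineSystem hirr hsc hθ).IsMinimal (finiteNodes b) u := by
  constructor
  · intro h ω hω
    obtain ⟨v, hv⟩ := wordProd_of_finiteNodes θ hω
    rw [affineSystem_word, hv]
    exact h v
  · intro h v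
    obtain ⟨ω, hω, hv⟩ := exists_finite_word b θ v
    rw [← hv]
    exact h ω hω

/-- Every finite element has a reduced word in the finite nodes. -/
theorem exists_reduced_finite_word (v : P.weylGroup) : ∃ ω : List (Node b),
    (∀ i ∈ ω, i ∈ finiteNodes b) ∧ wordProd b θ ω = ofFinite P v ∧
      (affineSystem hirr hsc hθ).Reduced ω := by
  obtain ⟨ω, hω, hv⟩ := exists_finite_word b θ v
  obtain ⟨ω', hω', hw, hl⟩ := (ReflectionSystem.isMinimal_one
    (R := affineSystem hirr hsc hθ) (J := finiteNodes b)).exists_word ω hω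
  refine ⟨ω', hω', by rw [← hv]; exact hw, ?_⟩
  rwa [one_mul, ReflectionSystem.length_one, zero_add, ← hw] at hl

theorem len_mul_of_longest {m : P.weylGroup}
    (hm : ∀ v : P.weylGroup, len b θ (ofFinite P v) ≤ len b θ (ofFinite P m)) (v : P.weylGroup) :
    len b θ (ofFinite P (m * v)) + len b θ (ofFinite P v) = len b θ (ofFinite P m) := by
  -- `m` sends positive roots to negative roots
  have hsimple (k : ι) (hk : k ∈ b.support) : ¬ b.IsPos (m • k) := by
    intro hp
    have h1 := (affineSystem hirr hsc hθ).length_mul_s_of_pos (g := ofFinite P m)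
      (i := some ⟨k, hk⟩) ((ofFinite_smul_isPos m k).2 hp)
    have h2 := hm (m * RootPairing.weylGroup.ofIdx P k)
    rw [map_mul] at h2
    exact absurd (h1.symm.trans_le h2) (Nat.not_succ_le_self _)
  have hneg (k : ι) (hk : b.IsPos k) : ¬ b.IsPos (m • k) := by
    refine RootPairing.Base.IsPos.induction_on_add (p := fun k => ¬ b.IsPos (m • k)) hk hsimple ?_
    intro i j k hk hi hj
    have hj := hsimple j hj
    have h : P.root (m • k) = P.root (m • i) + P.root (m • j) := by
      rw [root_smul, root_smul, root_smul, hk, smul_add]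
    rw [b.isPos_iff] at hi hj ⊢
    have := b.height_add h
    omega
  obtain ⟨ω, hω, hv, hr⟩ := exists_reduced_finite_word hirr hsc hθ v
  rw [map_mul, ← hv]
  clear hv
  induction ω using List.reverseRecOn with
  | nil => simp [wordProd, len_one]
  | append_singleton ω i ih =>
    obtain ⟨hr', hp⟩ := (ReflectionSystem.reduced_concat_iff _ _ _).1 hr
    have ih := ih (fun j hj => hω j (by simp [hj])) hr'
    obtain ⟨x, hx⟩ := wordProd_of_finiteNodes θ fun j hj =>
      hω j (List.mem_append_left [i] hj)
    obtain ⟨j, rfl⟩ := hω i (by simp)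
    rw [affineSystem_word, hx] at hp
    have hp' := hneg _ ((ofFinite_smul_isPos x (j : ι)).1 hp)
    have hn : ¬ (affineSystem hirr hsc hθ).pos
        ((ofFinite P m * wordProd b θ ω) • (affineSystem hirr hsc hθ).root (some j)) := by
      rw [hx, ← map_mul]
      intro h
      have := (ofFinite_smul_isPos (m * x) (j : ι)).1 h
      rw [mul_smul] at this
      exact hp' this
    have h1 := (affineSystem hirr hsc hθ).length_mul_s_of_neg hn
    have h2 : len b θ (wordProd b θ (ω ++ [some j])) = ω.length + 1 := by
      have : len b θ (wordProd b θ (ω ++ [some j])) = (ω ++ [some j]).length := hr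
      simpa using this
    have h3 : len b θ (wordProd b θ ω) = ω.length := hr'
    have h4 : ofFinite P m * wordProd b θ (ω ++ [some j]) =
      ofFinite P m * wordProd b θ ω * simpleRefl b θ (some j) := by simp [wordProd, mul_assoc]
    rw [affineSystem_length, affineSystem_s] at h1
    rw [h4, h2]
    omega

/-- For each finite `v₀ ≠ 1` there is a polynomial without constant term on which, up to constant
terms, only the divided difference operator of `v₀` does not vanish. -/
theorem exists_dual_polynomial {v₀ : P.weylGroup} (hv₀ : v₀ ≠ 1) :
    ∃ t : SymmetricAlgebra ℤ X, evalZero t = 0 ∧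
      ∀ (v : P.weylGroup) (ω : List (Node b)), (∀ i ∈ ω, i ∈ finiteNodes b) →
        wordProd b θ ω = ofFinite P v → (affineSystem hirr hsc hθ).Reduced ω →
        (v = v₀ → evalZero (demWord b θ ω t) ≠ 0) ∧
          (v ≠ v₀ → evalZero (demWord b θ ω t) = 0) := by
  have := finite_weylGroup P hsc
  obtain ⟨m, hm⟩ := Finite.exists_max fun v : P.weylGroup => len b θ (ofFinite P v)
  obtain ⟨μ, hμ⟩ := exists_regular_dominant hsc b
  have hinv (v : P.weylGroup) : len b θ (ofFinite P v⁻¹) = len b θ (ofFinite P v) := by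
    rw [map_inv]
    exact (affineSystem hirr hsc hθ).length_inv _
  have hm' (v : P.weylGroup) : len b θ (ofFinite P v) ≤ len b θ (ofFinite P m⁻¹) := by
    rw [hinv]
    exact hm v
  -- the lengths of `v` and of `v⁻¹ m` add up to the length of `m`
  have hcompl (v : P.weylGroup) :
      len b θ (ofFinite P (v⁻¹ * m)) + len b θ (ofFinite P v) = len b θ (ofFinite P m) := by
    have := len_mul_of_longest hirr hsc hθ hm' v
    rwa [hinv m, ← hinv (m⁻¹ * v), mul_inv_rev, inv_inv] at this
  have hzero {v : P.weylGroup} (h : len b θ (ofFinite P v) = 0) : v = 1 := by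
    have h1 := (affineSystem hirr hsc hθ).eq_one_of_length_eq_zero h
    exact SemidirectProduct.inr_injective (h1.trans (map_one _).symm)
  obtain ⟨σ, hσJ, hσ, hσr⟩ := exists_reduced_finite_word hirr hsc hθ (v₀⁻¹ * m)
  have hσl : len b θ (ofFinite P (v₀⁻¹ * m)) = σ.length := hσ ▸ hσr
  have hc₀ := hcompl v₀
  refine ⟨demWord b θ σ (SymmetricAlgebra.ι ℤ X μ ^ len b θ (ofFinite P m)), ?_, ?_⟩
  · refine evalZero_demWord_pow_of_ne hirr hsc hθ μ hμ _ _ fun h => hv₀ (hzero ?_)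
    omega
  · intro v ω hωJ hω hωr
    have hωl : len b θ (ofFinite P v) = ω.length := hω ▸ hωr
    have hw : wordProd b θ (ω ++ σ) = ofFinite P (v * (v₀⁻¹ * m)) := by
      rw [map_mul, ← hω, ← hσ]
      simp [wordProd]
    rw [← demWord_append]
    constructor
    · rintro rfl
      rw [mul_inv_cancel_left] at hw
      have hl : (ω ++ σ).length = len b θ (ofFinite P m) := by
        rw [List.length_append]
        omega
      refine (evalZero_demWord_pow_pos hirr hsc hθ μ hμ _ _ hl ?_ ?_).ne'
      · change len b θ (wordProd b θ (ω ++ σ)) = _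
        rw [hw, hl]
      · exact fun i hi => (List.mem_append.1 hi).elim (hωJ i) (hσJ i)
    · intro hne
      by_cases hr : (affineSystem hirr hsc hθ).Reduced (ω ++ σ)
      · refine evalZero_demWord_pow_of_ne hirr hsc hθ μ hμ _ _ fun hl => hne ?_
        have hl' : len b θ (ofFinite P (v * (v₀⁻¹ * m))) = len b θ (ofFinite P m) := by
          rw [← hw, ← hl]
          exact hr
        have h1 := hcompl (v * (v₀⁻¹ * m))
        have h2 := hzero (v := (v * (v₀⁻¹ * m))⁻¹ * m) (by omega)
        rwa [inv_mul_eq_one, ← mul_assoc, mul_eq_right, mul_inv_eq_one] at h2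
      · rw [demWord_eq_zero_of_not_reduced hirr hsc hθ hr, map_zero]

end Longest

/-! ### Grassmannian coefficients -/

section Coefficients

variable {b : P.Base} {θ : ι}

theorem symAct_one (s : SymmetricAlgebra ℤ X) : symAct P 1 s = s := by
  have : symAct P 1 = AlgHom.id ℤ (SymmetricAlgebra ℤ X) := by
    refine SymmetricAlgebra.algHom_ext (LinearMap.ext fun μ => ?_)
    simp
  rw [this]
  rfl

/-- The operators of finite nodes preserve the span of the finite Weyl group. -/
theorem regWord_support_finite {ω : List (Node b)} (hω : ∀ i ∈ ω, i ∈ finiteNodes b)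
    {z : RegularModule P} (hz : ∀ w, z w ≠ 0 → ∃ v, w = ofFinite P v) (w : AffineWeyl P)
    (hw : regWord b θ ω z w ≠ 0) : ∃ v, w = ofFinite P v := by
  classical
  induction ω generalizing w with
  | nil => exact hz w hw
  | cons i ω ih =>
    have ih := ih fun j hj => hω j (List.mem_cons_of_mem i hj)
    obtain ⟨k, rfl⟩ := hω i List.mem_cons_self
    by_contra hn
    have h1 : regWord b θ ω z w = 0 := by
      by_contra h
      exact hn (ih w h)
    have h2 : regWord b θ ω z (simpleRefl b θ (some k) * w) = 0 := by
      by_contra h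
      obtain ⟨v, hv⟩ := ih _ h
      refine hn ⟨RootPairing.weylGroup.ofIdx P k * v, ?_⟩
      rw [map_mul, ← hv]
      change w = simpleRefl b θ (some k) * (simpleRefl b θ (some k) * w)
      rw [← mul_assoc, simpleRefl_mul_self, one_mul]
    rw [regWord_cons, regOp_apply, h1, h2, map_zero, map_zero, ite_self, add_zero] at hw
    exact hw rfl

variable [Finite ι] [P.IsReduced] (hirr : IsIrreducibleDatum P)
  (hsc : Submodule.span ℤ (Set.range P.coroot) = ⊤) (hθ : IsHighestRoot b θ)

include hirr hsc hθ

/-- Each operator raises the minimal length of a coset of the finite Weyl group by at most one. -/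
theorem exists_len_le_of_regWord_apply_ne_zero (ω : List (Node b)) {z : RegularModule P}
    (hz : ∀ w, z w ≠ 0 → ∃ v, w = ofFinite P v) (w : AffineWeyl P)
    (hw : regWord b θ ω z w ≠ 0) : ∃ v, len b θ (w * ofFinite P v) ≤ ω.length := by
  classical
  induction ω generalizing w with
  | nil =>
    obtain ⟨v, rfl⟩ := hz w hw
    refine ⟨v⁻¹, ?_⟩
    rw [← map_mul, mul_inv_cancel, map_one, len_one, List.length_nil]
  | cons i ω ih =>
    by_cases h1 : regWord b θ ω z w = 0
    · by_cases h2 : regWord b θ ω z (simpleRefl b θ i * w) = 0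
      · rw [regWord_cons, regOp_apply, h1, h2, map_zero, map_zero, ite_self, add_zero] at hw
        exact absurd rfl hw
      · obtain ⟨v, hv⟩ := ih _ h2
        have h3 := (affineSystem hirr hsc hθ).length_s_mul_le i
          (simpleRefl b θ i * w * ofFinite P v)
        rw [affineSystem_s, affineSystem_length, ← mul_assoc, ← mul_assoc, simpleRefl_mul_self,
          one_mul] at h3
        exact ⟨v, h3.trans (by simpa using hv)⟩
    · obtain ⟨v, hv⟩ := ih _ h1
      exact ⟨v, hv.trans (by simp)⟩

/-- The coefficient at a Grassmannian element `u` after applying a word not longer than `u` to an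
element supported on the finite Weyl group: only a reduced word for `u` contributes, and only
through the coefficient at `1`. -/
theorem regWord_apply_grassmannian (ω : List (Node b)) {z : RegularModule P}
    (hz : ∀ w, z w ≠ 0 → ∃ v, w = ofFinite P v) {u : AffineWeyl P} (hu : IsGrassmannian b θ u)
    (hl : ω.length ≤ len b θ u) [Decidable (wordProd b θ ω = u)] :
    regWord b θ ω z u = if wordProd b θ ω = u then symAct P u.right (z 1) else 0 := by
  classical
  induction ω generalizing u with
  | nil =>
    split_ifs with h
    · obtain rfl : (1 : AffineWeyl P) = u := h
      rw [SemidirectProduct.one_right, symAct_one, regWord_nil]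
    · by_contra hne
      obtain ⟨v, rfl⟩ := hz u hne
      have h1 := hu v⁻¹
      rw [← map_mul, mul_inv_cancel, map_one, len_one] at h1
      exact h ((affineSystem hirr hsc hθ).eq_one_of_length_eq_zero (Nat.le_zero.1 h1)).symm
  | cons i ω ih =>
    rw [List.length_cons] at hl
    have h0 : regWord b θ ω z u = 0 := by
      by_contra hne
      obtain ⟨v, hv⟩ := exists_len_le_of_regWord_apply_ne_zero hirr hsc hθ ω hz u hne
      have := hu v
      omega
    have hword : wordProd b θ (i :: ω) = simpleRefl b θ i * wordProd b θ ω := by simp [wordProd]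
    have hiff : wordProd b θ (i :: ω) = u ↔ wordProd b θ ω = simpleRefl b θ i * u := by
      rw [hword]
      constructor
      · rintro rfl
        rw [← mul_assoc, simpleRefl_mul_self, one_mul]
      · intro h
        rw [h, ← mul_assoc, simpleRefl_mul_self, one_mul]
    have hstep (w : AffineWeyl P) : len b θ w ≤ len b θ (simpleRefl b θ i * w) + 1 := by
      have := (affineSystem hirr hsc hθ).length_s_mul_le i (simpleRefl b θ i * w)
      rwa [affineSystem_s, affineSystem_length, ← mul_assoc, simpleRefl_mul_self, one_mul] at this
    rw [regWord_cons, regOp_apply, h0, map_zero, zero_add]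
    by_cases hlt : len b θ (simpleRefl b θ i * u) < len b θ u
    · have hu' : IsGrassmannian b θ (simpleRefl b θ i * u) := by
        intro v
        have h1 := hu v
        have h2 := hstep (u * ofFinite P v)
        rw [mul_assoc]
        omega
      have h1 := hstep u
      rw [if_pos hlt, ih hu' (by omega)]
      split_ifs with h2 h3 h3
      · rw [← symAct_mul, ← SemidirectProduct.mul_right, ← mul_assoc, simpleRefl_mul_self, one_mul]
      · exact absurd (hiff.2 h2) h3
      · exact absurd (hiff.1 h3) h2
      · exact map_zero _
    · rw [if_neg hlt, if_neg]
      intro h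
      have h1 := (affineSystem hirr hsc hθ).length_word_le ω
      rw [affineSystem_word, affineSystem_length, hiff.1 h] at h1
      omega

/-- The factorization `w = u v` with `u` Grassmannian and `v` finite, spelled by a reduced word. -/
theorem exists_grassmannian_factorization (w : AffineWeyl P) :
    ∃ (u : AffineWeyl P) (v : P.weylGroup) (ω ω' : List (Node b)), IsGrassmannian b θ u ∧
      w = u * ofFinite P v ∧ wordProd b θ ω = u ∧ ω.length = len b θ u ∧
      (∀ i ∈ ω', i ∈ finiteNodes b) ∧ wordProd b θ ω' = ofFinite P v ∧
      (affineSystem hirr hsc hθ).Reduced (ω ++ ω') := by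
  have := finite_weylGroup P hsc
  obtain ⟨x, hx⟩ := Finite.exists_min fun x : P.weylGroup => len b θ (w * ofFinite P x)
  have hu : IsGrassmannian b θ (w * ofFinite P x) := by
    intro v
    rw [mul_assoc, ← map_mul]
    exact hx (x * v)
  obtain ⟨ω, hω, hl⟩ := (affineSystem hirr hsc hθ).exists_reduced (w * ofFinite P x)
  obtain ⟨σ, hσJ, hσ⟩ := exists_finite_word b θ x⁻¹
  obtain ⟨ω', hJ, hω', hl'⟩ := ((isGrassmannian_iff hirr hsc hθ _).1 hu).exists_word σ hσJ
  refine ⟨_, x⁻¹, ω, ω', hu, ?_, hω, hl, hJ, hω'.trans hσ, ?_⟩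
  · rw [mul_assoc, ← map_mul, mul_inv_cancel, map_one, mul_one]
  · rw [ReflectionSystem.Reduced, ReflectionSystem.word_append, hω, hω', hl', List.length_append,
      hl]

end Coefficients

end

end AffineNilHecke

end

theorem mainTheorem7 {ι X Y : Type*} [Finite ι] [AddCommGroup X] [AddCommGroup Y]
    (P : RootDatum ι X Y) [P.IsReduced]
    (hirr : AffineNilHecke.IsIrreducibleDatum P)
    (hsc : Submodule.span ℤ (Set.range P.coroot) = ⊤)
    (b : P.Base) (θ : ι) (hθ : AffineNilHecke.IsHighestRoot b θ)
    (a : AffineNilHecke.NilHecke b θ) (ha : a ∈ AffineNilHecke.fominStanley b θ) (ha0 : a ≠ 0) :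
    ∃ c : AffineNilHecke.AffineWeyl P →₀ ℤ,
      a = AffineNilHecke.intExpansion b θ c ∧
      (∀ c' : AffineNilHecke.AffineWeyl P →₀ ℤ,
        a = AffineNilHecke.intExpansion b θ c' → c' = c) ∧
      ∃ w : AffineNilHecke.AffineWeyl P,
        AffineNilHecke.IsGrassmannian b θ w ∧ c w ≠ 0 := by
  classical
  obtain ⟨c, rfl⟩ := AffineNilHecke.exists_intExpansion_of_mem_nilCoxeter hirr hsc hθ ha.1
  have hinj := AffineNilHecke.intExpansion_injective hirr hsc hθ
  refine ⟨c, rfl, fun c' h => hinj h.symm, ?_⟩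
  by_contra! hcon
  have hc : c.support.Nonempty := by
    rw [Finset.nonempty_iff_ne_empty, Ne, Finsupp.support_eq_empty]
    rintro rfl
    exact ha0 Finsupp.sum_zero_index
  choose U V Ω Ω' hU hUV hΩ hΩl hJ hΩ' hred using
    AffineNilHecke.exists_grassmannian_factorization hirr hsc hθ
  -- `w₀ = U w₀ * V w₀` lies in a coset of maximal minimal length.
  obtain ⟨w₀, hw₀, hmax⟩ := Finset.exists_max_image c.support
    (fun w => AffineNilHecke.len b θ (U w)) hc
  rw [Finsupp.mem_support_iff] at hw₀
  have hV : V w₀ ≠ 1 := by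
    intro h
    have h1 := hUV w₀
    rw [h, map_one, mul_one] at h1
    exact hw₀ (hcon w₀ (h1 ▸ hU w₀))
  obtain ⟨t, ht, htV⟩ := AffineNilHecke.exists_dual_polynomial hirr hsc hθ hV
  -- the contribution of `A_w` to the coefficient of `φ₀(a t)` at `U w₀`
  have hterm (w) (hw : w ∈ c.support) :
      AffineNilHecke.regRep hirr hsc hθ (AffineNilHecke.basisA b θ w) (Finsupp.single 1 t)
        (U w₀) = if U w = U w₀ then AffineNilHecke.symAct P (U w₀).right
          (AffineNilHecke.demWord b θ (Ω' w) t) else 0 := by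
    have hword : AffineNilHecke.wordProd b θ (Ω w ++ Ω' w) = w := by
      conv_rhs => rw [hUV w, ← hΩ, ← hΩ']
      simp [AffineNilHecke.wordProd]
    have hsupp (x) (hx : (Finsupp.single 1 t : AffineNilHecke.RegularModule P) x ≠ 0) :
        ∃ v, x = AffineNilHecke.ofFinite P v := by
      refine ⟨1, ?_⟩
      rw [map_one]
      by_contra h
      exact hx (Finsupp.single_eq_of_ne h)
    have h := AffineNilHecke.regWord_apply_grassmannian hirr hsc hθ (Ω w)
      (AffineNilHecke.regWord_support_finite (θ := θ) (hJ w) hsupp) (hU w₀)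
      ((hΩl w).trans_le (hmax w hw))
    rw [AffineNilHecke.regWord_apply_one, Finsupp.single_eq_same, hΩ w] at h
    conv_lhs => rw [← hword, AffineNilHecke.basisA_wordProd hirr hsc hθ (hred w),
      AffineNilHecke.regRep_prod, AffineNilHecke.regWord_append]
    exact h
  have key := AffineNilHecke.evalZero_regRep_of_mem_fominStanley hirr hsc hθ ha t (U w₀)
  rw [ht, zero_mul, AffineNilHecke.regRep_intExpansion, Finsupp.sum, Finsupp.finsetSum_apply,
    map_sum, Finset.sum_eq_single w₀] at key
  · rw [Finsupp.smul_apply, map_zsmul, hterm w₀ (Finsupp.mem_support_iff.2 hw₀), if_pos rfl,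
      AffineNilHecke.evalZero_symAct, smul_eq_mul, mul_eq_zero] at key
    exact key.elim hw₀ ((htV _ _ (hJ w₀) (hΩ' w₀) (hred w₀).of_append.2).1 rfl)
  · intro w hw hne
    rw [Finsupp.smul_apply, map_zsmul, hterm w hw]
    split_ifs with hu
    · have hne' : V w ≠ V w₀ := fun h => hne (by rw [hUV w, hUV w₀, hu, h])
      rw [AffineNilHecke.evalZero_symAct,
        (htV _ _ (hJ w) (hΩ' w) (hred w).of_append.2).2 hne', smul_zero]
    · rw [map_zero, smul_zero]
  · intro h
    exact absurd (Finsupp.mem_support_iff.2 hw₀) h
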